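/- Write $[n]=\{1,\dots,n\}$ and $2^{[n]}$ for its power set. Families $\mathcal F_1,\mathcal F_2,\mathcal F_3\subset 2^{[n]}$ are called cross partition-free if there are no $A\in\mathcal F_1$, $B\in\mathcal F_2$, $C\in\mathcal F_3$ such that one of the sets $A,B,C$ is the disjoint union of the other two. For $n=3m+l$ with $0\le l\le 2$ put $\mathcal K(n)=\{K\subset[n]: m+1\le |K|\le 2m+1\}$, and for $\mathcal F\subset 2^{[n]}$ let $\mathcal F^d=\{F\subset[n+1]: F\cap[n]\in\mathcal F\}$. Theorem. Let $\mathcal F_1,\mathcal F_2,\mathcal F_3\subset 2^{[n]}$ be cross partition-free, where either $n=3m+1$ with $m\ge 2$, or $n=3m+2$ with $m\ge 6$. Then $$|\mathcal F_1|+|\mathcal F_2|+|\mathcal F_3|\le 3\sum_{t=m+1}^{2m+1}\binom nt .$$ For $n=3m+1$, equality holds if and only if $\mathcal F_1=\mathcal F_2=\mathcal F_3=\mathcal K(3m+1)$. For $n=3m+2$, equality holds if and only if, up to a permutation of the indices of the three families and a permutation of the elements of the ground set $[n]$, one of the following holds: (i) $\mathcal F_1=\mathcal F_2=\mathcal F_3=\mathcal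 K(3m+2)$; (ii) $\mathcal F_1=\mathcal F_2=\mathcal F_3=\mathcal K(3m+1)^d$; (iii) $\mathcal F_1=\{F\subset[n]: m+2\le|F|\le 2m+1\}$ and $\mathcal F_2=\mathcal F_3=\{F\subset[n]: m+1\le|F|\le 2m+2\}$. -/

import Mathlib

/-- Three families of subsets of `[n]` are cross partition-free if there are no `A ∈ F₁`,
`B ∈ F₂`, `C ∈ F₃` such that one of these sets is the disjoint union of the other two. -/
def CrossPartitionFree {n : ℕ} (F₁ F₂ F₃ : Finset (Finset (Fin n))) : Prop :=
  ∀ A ∈ F₁, ∀ B ∈ F₂, ∀ C ∈ F₃,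
    ¬ (Disjoint B C ∧ A = B ∪ C) ∧
    ¬ (Disjoint A C ∧ B = A ∪ C) ∧
    ¬ (Disjoint A B ∧ C = A ∪ B)

/-- The family of all subsets of `[n]` whose size lies between `a` and `b` (inclusive). -/
def layers (n a b : ℕ) : Finset (Finset (Fin n)) :=
  Finset.univ.filter fun S => a ≤ S.card ∧ S.card ≤ b

/-- Kleitman's family `𝒦(n) = {S ⊆ [n] : m + 1 ≤ |S| ≤ 2m + 1}`, where `n = 3m + l`, `0 ≤ l ≤ 2`,
that is, `m = ⌊n / 3⌋`. -/
def kleitmanFamily (n : ℕ) : Finset (Finset (Fin n)) :=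
  layers n (n / 3 + 1) (2 * (n / 3) + 1)

/-- The double `F^d = {S ⊆ [n + 1] : S ∩ [n] ∈ F}` of a family `F` of subsets of `[n]`; here `[n]`
sits in `[n + 1]` as the complement of the last element. -/
def double {n : ℕ} (F : Finset (Finset (Fin n))) : Finset (Finset (Fin (n + 1))) :=
  Finset.univ.filter fun S => (Finset.univ.filter fun x : Fin n => x.castSucc ∈ S) ∈ F

/-- The image of a family under a permutation of the ground set. -/
def relabel {n : ℕ} (τ : Equiv.Perm (Fin n)) (F : Finset (Finset (Fin n))) :
    Finset (Finset (Fin n)) :=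
  F.image fun S => S.image τ

/-! Put m = M + 2, let P(t), between 0 and 3, be the sum over the three families of the proportion
of t-sets they contain, and call the layers m+1, ..., 2m+1 inner, the others outer. The bound says
that ∑ C(n,t) P(t) over outer layers is at most ∑ C(n,t) (3 - P(t)) over inner ones: what is gained
outside is lost inside.

Near the boundary this comes from averaging. Split [n] at random into classes of fixed sizes and
give the three families random roles. A linear inequality valid for the membership indicators of all
unions of classes then becomes an inequality between the P(t) (`affine_density`). The weights in
`local_one` and `local_two` are chosen so that the layers m-1, m, m+1, 2m+1, 2m+2, 2m+3 receive
exactly their binomial coefficients; this rests on C(n,m+1) = C(n,m) + 2C(n,m-1) for n = 3m+1 and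
C(n,m+1) = 2C(n,m) for n = 3m+2. Otherwise only the layers m+2 and 2m occur, with small weights. The
farther outer layers are bounded through triples s, t, s+t with the other two sizes inner
(`CrossFree.totalDensity_add_le`); their binomials at least halve from layer to layer, so the layers
m+2, ..., 2m absorb them with strict slack.

Equality therefore fills the layers m+2, ..., 2m in every family and makes every local inequality
tight. For n = 3m+1 this leaves no missing set on the layers m+1 and 2m+1. For n = 3m+2 only the
layers m+1 and 2m+2 stay undetermined, linked by 1_i(S ∪ T) = (1 - 1_j(S)) + (1 - 1_k(T)), where 1_i
is the indicator of the i-th family. If the families agree on layer m+1, the sets missing there form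
an intersecting family which is empty or a star (`star_of_balanced`): examples (i) and (ii). If they
differ, an exchange argument gives (iii). -/

section
open Finset

/-! ### Averaging over colourings -/

/-- The union of the colour classes of `c` with colours in `s`. -/
def colorUnion {n r : ℕ} (c : Fin n → Fin r) (s : Finset (Fin r)) : Finset (Fin n) :=
  univ.filter fun x => c x ∈ s

/-- The colourings of `[n]` whose `i`-th colour class has size `k i`. -/
def colorings (n : ℕ) {r : ℕ} (k : Fin r → ℕ) : Finset (Fin n → Fin r) :=
  univ.filter fun c => ∀ i, (univ.filter fun x => c x = i).card = k i

/-- The indicator of membership in a family. -/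
def ind {α : Type*} [DecidableEq α] (F : Finset α) (S : α) : ℚ := if S ∈ F then 1 else 0

/-- The proportion of `t`-subsets of `[n]` that belong to `F`. -/
def density {n : ℕ} (F : Finset (Finset (Fin n))) (t : ℕ) : ℚ :=
  (F.filter fun S => S.card = t).card / (n.choose t : ℚ)

lemma colorUnion_union {n r : ℕ} (c : Fin n → Fin r) (s t : Finset (Fin r)) :
    colorUnion c (s ∪ t) = colorUnion c s ∪ colorUnion c t := by
  ext x; simp [colorUnion]

lemma disjoint_colorUnion {n r : ℕ} (c : Fin n → Fin r) {s t : Finset (Fin r)}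
    (h : Disjoint s t) : Disjoint (colorUnion c s) (colorUnion c t) := by
  rw [Finset.disjoint_left] at h ⊢
  intro x hx hy
  simp only [colorUnion, mem_filter, mem_univ, true_and] at hx hy
  exact h hx hy

lemma card_colorUnion {n r : ℕ} {k : Fin r → ℕ} {c : Fin n → Fin r} (hc : c ∈ colorings n k)
    (s : Finset (Fin r)) : (colorUnion c s).card = ∑ i ∈ s, k i := by
  simp only [colorings, mem_filter, mem_univ, true_and] at hc
  rw [Finset.card_eq_sum_card_fiberwise (f := c) (t := s)]
  · refine Finset.sum_congr rfl fun i hi => ?_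
    rw [← hc i]
    congr 1
    ext x
    simp only [colorUnion, mem_filter, mem_univ, true_and]
    constructor
    · rintro ⟨_, h⟩; exact h
    · intro h; exact ⟨h ▸ hi, h⟩
  · intro x hx
    simpa [colorUnion] using hx

lemma colorings_nonempty {n r : ℕ} (k : Fin r → ℕ) (h : ∑ i, k i = n) :
    (colorings n k).Nonempty := by
  have e : Fin n ≃ (Σ i, Fin (k i)) := Fintype.equivOfCardEq (by simp [h])
  refine ⟨fun x => (e x).1, ?_⟩
  simp only [colorings, mem_filter, mem_univ, true_and]
  intro i
  rw [← Fintype.card_fin (k i), ← Finset.card_univ]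
  refine Finset.card_bij' (fun x hx => Fin.cast (by simp at hx; rw [hx]) (e x).2)
    (fun y _ => e.symm ⟨i, y⟩) ?_ ?_ ?_ ?_
  · intros; simp
  · intros; simp
  · intro x hx
    simp only [mem_filter, mem_univ, true_and] at hx
    subst hx
    simp
  · intro y _
    have h1 : ∀ z : (Σ i, Fin (k i)), z = ⟨i, y⟩ → z.2.val = y.val := by
      rintro z rfl; rfl
    exact Fin.ext (h1 _ (e.apply_symm_apply _))

lemma exists_perm_map_eq {n : ℕ} {S T : Finset (Fin n)} (h : S.card = T.card) :
    ∃ τ : Equiv.Perm (Fin n), ∀ x, τ x ∈ T ↔ x ∈ S := by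
  have e : {x // x ∈ S} ≃ {x // x ∈ T} := Fintype.equivOfCardEq (by simp [h])
  refine ⟨e.extendSubtype, fun x => ?_⟩
  by_cases hx : x ∈ S
  · simp only [hx, iff_true]
    exact e.extendSubtype_mem x hx
  · simp only [hx, iff_false]
    exact e.extendSubtype_not_mem x hx

/-- A permutation of the points carrying S to T acts on the colourings of a given type. -/
lemma card_colorings_fiber {n r : ℕ} (k : Fin r → ℕ) (s : Finset (Fin r))
    {S T : Finset (Fin n)} (h : S.card = T.card) :
    ((colorings n k).filter fun c => colorUnion c s = S).card =
      ((colorings n k).filter fun c => colorUnion c s = T).card := by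
  obtain ⟨τ, hτ⟩ := exists_perm_map_eq h
  refine Finset.card_bij' (fun c _ => c ∘ τ.symm) (fun c _ => c ∘ τ) ?_ ?_ ?_ ?_
  · intro c hc
    simp only [colorings, mem_filter, mem_univ, true_and] at hc ⊢
    refine ⟨fun i => ?_, ?_⟩
    · rw [← hc.1 i]
      exact Finset.card_bij' (fun x _ => τ.symm x) (fun x _ => τ x) (by simp) (by simp) (by simp)
        (by simp)
    · ext x
      have h1 := hτ (τ.symm x)
      rw [← hc.2] at h1
      simpa [colorUnion] using h1.symm
  · intro c hc
    simp only [colorings, mem_filter, mem_univ, true_and] at hc ⊢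
    refine ⟨fun i => ?_, ?_⟩
    · rw [← hc.1 i]
      exact Finset.card_bij' (fun x _ => τ x) (fun x _ => τ.symm x) (by simp) (by simp) (by simp)
        (by simp)
    · ext x
      have h1 := hτ x
      rw [← hc.2] at h1
      simpa [colorUnion] using h1
  · intro c _; ext x; simp
  · intro c _; ext x; simp

lemma sum_card_colorings_fiber {n r : ℕ} (k : Fin r → ℕ) (s : Finset (Fin r))
    (F : Finset (Finset (Fin n))) :
    ∑ c ∈ colorings n k, ind F (colorUnion c s) =
      ∑ S ∈ F.filter (fun S => S.card = ∑ i ∈ s, k i),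
        (((colorings n k).filter fun c => colorUnion c s = S).card : ℚ) := by
  have h1 : ∀ c ∈ colorings n k, ind F (colorUnion c s) =
      ∑ S ∈ F.filter (fun S => S.card = ∑ i ∈ s, k i), if colorUnion c s = S then (1 : ℚ) else 0 := by
    intro c hc
    rw [Finset.sum_ite_eq]
    simp [ind, card_colorUnion hc]
  rw [Finset.sum_congr rfl h1, Finset.sum_comm]
  refine Finset.sum_congr rfl fun S _ => ?_
  rw [Finset.card_filter]
  push_cast
  rfl

/-- Over all colourings of a fixed type, the probability that the union of some prescribed colour
classes belongs to `F` is the density of `F` on the corresponding layer. -/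
lemma sum_ind_colorUnion {n r : ℕ} (k : Fin r → ℕ) (hk : ∑ i, k i = n) (s : Finset (Fin r))
    (F : Finset (Finset (Fin n))) :
    ∑ c ∈ colorings n k, ind F (colorUnion c s) =
      (colorings n k).card * density F (∑ i ∈ s, k i) := by
  set t := ∑ i ∈ s, k i with ht
  have htn : t ≤ n := by
    rw [← hk]; exact Finset.sum_le_sum_of_subset (subset_univ s)
  obtain ⟨S₀, -, hS₀⟩ := Finset.exists_subset_card_eq (s := (univ : Finset (Fin n))) (n := t)
    (by simpa using htn)
  set N : ℚ := (((colorings n k).filter fun c => colorUnion c s = S₀).card : ℚ)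
  have key : ∀ F : Finset (Finset (Fin n)), ∑ c ∈ colorings n k, ind F (colorUnion c s) =
      ((F.filter fun S => S.card = t).card : ℚ) * N := by
    intro F
    rw [sum_card_colorings_fiber, ← nsmul_eq_mul, ← Finset.sum_const]
    refine Finset.sum_congr rfl fun S hS => ?_
    rw [mem_filter] at hS
    rw [card_colorings_fiber k s (hS.2.trans hS₀.symm)]
  -- The family of all sets evaluates the unknown N: the number of colourings is N times the number
  -- of t-sets.
  have h2 := key univ
  have h3 : (univ.filter fun S : Finset (Fin n) => S.card = t).card = n.choose t := by
    rw [← Finset.powerset_univ, ← Finset.powersetCard_eq_filter]; simp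
  rw [h3] at h2
  simp only [ind, mem_univ, if_true, sum_const, nsmul_eq_mul, mul_one] at h2
  have hpos : (0 : ℚ) < n.choose t := by exact_mod_cast Nat.choose_pos htn
  rw [key, h2, density]
  field_simp

/-! ### Averaging over the roles of three families -/

/-- The sum over three families of the densities on layer `t`. -/
def totalDensity {n : ℕ} (F : Fin 3 → Finset (Finset (Fin n))) (t : ℕ) : ℚ :=
  ∑ i, density (F i) t

/-- The sum does not depend on i, since right multiplication by a transposition permutes the
summands; summing over i counts each value once for each of the six permutations. -/
lemma sum_perm_fin_three (f : Fin 3 → ℚ) (i : Fin 3) :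
    ∑ ρ : Equiv.Perm (Fin 3), f (ρ i) = 2 * ∑ j, f j := by
  have h1 : ∀ j, ∑ ρ : Equiv.Perm (Fin 3), f (ρ j) = ∑ ρ : Equiv.Perm (Fin 3), f (ρ i) := by
    intro j
    rw [← Equiv.sum_comp (Equiv.mulRight (Equiv.swap i j))]
    simp
  have h2 : ∑ j, ∑ ρ : Equiv.Perm (Fin 3), f (ρ j) = 6 * ∑ j, f j := by
    rw [Finset.sum_comm]
    simp only [Equiv.sum_comp]
    simp [Fintype.card_perm, Nat.factorial]
  rw [Finset.sum_congr rfl fun j _ => h1 j] at h2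
  simp only [sum_const, card_univ, Fintype.card_fin, nsmul_eq_mul] at h2
  push_cast at h2
  linarith

lemma sum_role_colorUnion {n r : ℕ} (k : Fin r → ℕ) (hk : ∑ i, k i = n)
    (F : Fin 3 → Finset (Finset (Fin n))) (i : Fin 3) (s : Finset (Fin r)) :
    ∑ ω ∈ (univ : Finset (Equiv.Perm (Fin 3))) ×ˢ colorings n k,
        ind (F (ω.1 i)) (colorUnion ω.2 s) =
      2 * (colorings n k).card * totalDensity F (∑ i ∈ s, k i) := by
  rw [Finset.sum_product]
  simp only [sum_ind_colorUnion k hk]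
  rw [sum_perm_fin_three (fun j => ((colorings n k).card : ℚ) * density (F j) (∑ i ∈ s, k i)),
    totalDensity, Finset.mul_sum, Finset.mul_sum]
  refine Finset.sum_congr rfl fun j _ => by ring

lemma card_roles {n r : ℕ} (k : Fin r → ℕ) :
    ((univ : Finset (Equiv.Perm (Fin 3))) ×ˢ colorings n k).card = 6 * (colorings n k).card := by
  rw [Finset.card_product]
  simp [Fintype.card_perm, Nat.factorial]

lemma sum_list_map {α β : Type*} (s : Finset α) (L : List β) (f : α → β → ℚ) :
    ∑ a ∈ s, (L.map (f a)).sum = (L.map fun b => ∑ a ∈ s, f a b).sum := by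
  induction L with
  | nil => simp
  | cons b L ih => simp [Finset.sum_add_distrib, ih]

/-- An affine expression in membership indicators that is nonnegative for every colouring and
every assignment of roles gives a nonnegative expression in the total densities; when the latter
vanishes, so do all the former. -/
lemma affine_density {n r : ℕ} (k : Fin r → ℕ) (hk : ∑ i, k i = n)
    (F : Fin 3 → Finset (Finset (Fin n))) (u : ℚ) (L : List (ℚ × Fin 3 × Finset (Fin r)))
    (h : ∀ (ρ : Equiv.Perm (Fin 3)) (c : Fin n → Fin r),
      0 ≤ u + (L.map fun t => t.1 * ind (F (ρ t.2.1)) (colorUnion c t.2.2)).sum) :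
    0 ≤ 3 * u + (L.map fun t => t.1 * totalDensity F (∑ l ∈ t.2.2, k l)).sum ∧
    (3 * u + (L.map fun t => t.1 * totalDensity F (∑ l ∈ t.2.2, k l)).sum ≤ 0 →
      ∀ (ρ : Equiv.Perm (Fin 3)), ∀ c ∈ colorings n k,
        u + (L.map fun t => t.1 * ind (F (ρ t.2.1)) (colorUnion c t.2.2)).sum = 0) := by
  have hpos : (0 : ℚ) < 2 * (colorings n k).card := by
    have := (colorings_nonempty k hk).card_pos
    positivity
  -- Per colouring the constant is counted six times, each indicator twice for each family; after
  -- division by twice the number of colourings 3u remains.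
  have hsum : ∑ ω ∈ (univ : Finset (Equiv.Perm (Fin 3))) ×ˢ colorings n k,
      (u + (L.map fun t => t.1 * ind (F (ω.1 t.2.1)) (colorUnion ω.2 t.2.2)).sum) =
      2 * (colorings n k).card *
        (3 * u + (L.map fun t => t.1 * totalDensity F (∑ l ∈ t.2.2, k l)).sum) := by
    rw [Finset.sum_add_distrib, sum_list_map, Finset.sum_const, card_roles]
    simp only [← Finset.mul_sum, sum_role_colorUnion k hk]
    rw [mul_add, ← List.sum_map_mul_left]
    congr 1
    · simp; ring
    · congr 1
      exact List.map_congr_left fun j _ => by ring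
  have hnn : ∀ ω ∈ (univ : Finset (Equiv.Perm (Fin 3))) ×ˢ colorings n k,
      0 ≤ u + (L.map fun t => t.1 * ind (F (ω.1 t.2.1)) (colorUnion ω.2 t.2.2)).sum :=
    fun ω _ => h ω.1 ω.2
  constructor
  · have := Finset.sum_nonneg hnn
    rw [hsum] at this
    exact nonneg_of_mul_nonneg_right this hpos
  · intro hle ρ c hc
    refine (Finset.sum_eq_zero_iff_of_nonneg hnn).1 ?_ (ρ, c) (by simp [hc])
    refine le_antisymm ?_ (Finset.sum_nonneg hnn)
    rw [hsum]
    exact mul_nonpos_of_nonneg_of_nonpos hpos.le hle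

/-! ### Cross partition-free triples in symmetric form -/

/-- `CrossPartitionFree` for an indexed triple of families, in a form symmetric in the indices. -/
def CrossFree {n : ℕ} (F : Fin 3 → Finset (Finset (Fin n))) : Prop :=
  ∀ i j k : Fin 3, i ≠ j → i ≠ k → j ≠ k → ∀ A ∈ F i, ∀ B ∈ F j, Disjoint A B → A ∪ B ∉ F k

lemma CrossPartitionFree.crossFree {n : ℕ} {F : Fin 3 → Finset (Finset (Fin n))}
    (h : CrossPartitionFree (F 0) (F 1) (F 2)) : CrossFree F := by
  intro i j k hij hik hjk A hA B hB hd hC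
  fin_cases i <;> fin_cases j <;> fin_cases k <;> simp at hij hik hjk hA hB hC
  · exact (h A hA B hB _ hC).2.2 ⟨hd, rfl⟩
  · exact (h A hA _ hC B hB).2.1 ⟨hd, rfl⟩
  · exact (h B hB A hA _ hC).2.2 ⟨hd.symm, union_comm _ _⟩
  · exact (h _ hC A hA B hB).1 ⟨hd, rfl⟩
  · exact (h B hB _ hC A hA).2.1 ⟨hd.symm, union_comm _ _⟩
  · exact (h _ hC B hB A hA).1 ⟨hd.symm, union_comm _ _⟩

lemma ind_eq_zero_or_one {α : Type*} [DecidableEq α] (F : Finset α) (S : α) :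
    ind F S = 0 ∨ ind F S = 1 := by
  unfold ind; split_ifs <;> simp

lemma ind_eq_one {α : Type*} [DecidableEq α] {F : Finset α} {S : α} : ind F S = 1 ↔ S ∈ F := by
  unfold ind; split_ifs with h <;> simp [h]

lemma ind_eq_zero {α : Type*} [DecidableEq α] {F : Finset α} {S : α} : ind F S = 0 ↔ S ∉ F := by
  unfold ind; split_ifs with h <;> simp [h]

lemma CrossFree.ind_add_le {n : ℕ} {F : Fin 3 → Finset (Finset (Fin n))} (h : CrossFree F)
    {i j k : Fin 3} (hij : i ≠ j) (hik : i ≠ k) (hjk : j ≠ k) {A B : Finset (Fin n)}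
    (hd : Disjoint A B) : ind (F i) A + ind (F j) B + ind (F k) (A ∪ B) ≤ 2 := by
  unfold ind
  split_ifs with h1 h2 h3 <;> norm_num
  exact h i j k hij hik hjk A h1 B h2 hd h3

/-- A `0`-`1` valuation of the unions of colour classes, for each of three roles, that obeys the
constraints of a cross partition-free triple. -/
structure CrossVal {r : ℕ} (e : Fin 3 → Finset (Fin r) → ℚ) : Prop where
  zero_or_one : ∀ i s, e i s = 0 ∨ e i s = 1
  add_le : ∀ i j k, i ≠ j → i ≠ k → j ≠ k → ∀ s t, Disjoint s t → e i s + e j t + e k (s ∪ t) ≤ 2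

lemma CrossFree.crossVal {n r : ℕ} {F : Fin 3 → Finset (Finset (Fin n))} (h : CrossFree F)
    (ρ : Equiv.Perm (Fin 3)) (c : Fin n → Fin r) :
    CrossVal fun i s => ind (F (ρ i)) (colorUnion c s) where
  zero_or_one _ _ := ind_eq_zero_or_one _ _
  add_le i j k hij hik hjk s t hst := by
    rw [colorUnion_union]
    exact h.ind_add_le (ρ.injective.ne hij) (ρ.injective.ne hik) (ρ.injective.ne hjk)
      (disjoint_colorUnion c hst)

/-! ### The local inequalities -/

/-- A0, A1, C1, C2 stand for outer sets, the other letters for inner ones. `c₁` and `c₂` charge A0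
and C1 to the losses a(1 - B) + a(1 - D') and b(1 - B) + b(1 - D), which use up the weights of B, D
and D'. A1 is paid by a missing m₁, m₂ or m₃, or else forces B = D = D' = 0; C2 is paid by a missing
m₄ or m₅, or else forces B = D = 0. In the forced cases the losses exceed what is owed because c < b
< a. -/
lemma local_arith_one {a b c A0 A1 C1 C2 B D D' m₁ m₂ m₃ m₄ m₅ : ℚ} (hc : 0 < c) (hcb : c < b)
    (hba : b < a) (hA0 : A0 = 0 ∨ A0 = 1) (hA1 : A1 = 0 ∨ A1 = 1) (hC1 : C1 = 0 ∨ C1 = 1)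
    (hC2 : C2 = 0 ∨ C2 = 1) (hB : B = 0 ∨ B = 1) (hD : D = 0 ∨ D = 1) (hD' : D' = 0 ∨ D' = 1)
    (h₁ : m₁ ≤ 1) (h₂ : m₂ ≤ 1) (h₃ : m₃ ≤ 1) (h₄ : m₄ ≤ 1) (h₅ : m₅ ≤ 1)
    (c₁ : A0 + B + D' ≤ 2) (c₂ : B + D + C1 ≤ 2) (c₃ : A1 + B + m₁ ≤ 2) (c₄ : A1 + D + m₂ ≤ 2)
    (c₅ : A1 + m₃ + D' ≤ 2) (c₆ : B + m₅ + C2 ≤ 2) (c₇ : D + m₄ + C2 ≤ 2) :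
    a * A0 + b * A1 + b * C1 + c * C2 + (a + b) * B + b * D + a * D' +
        b * m₁ + b * m₂ + b * m₃ + c * m₄ + c * m₅ ≤ 2 * a + 5 * b + 2 * c ∧
    (m₁ = 1 → m₂ = 1 → m₃ = 1 → m₄ = 1 → m₅ = 1 →
      a * A0 + b * A1 + b * C1 + c * C2 + (a + b) * B + b * D + a * D' +
        b * m₁ + b * m₂ + b * m₃ + c * m₄ + c * m₅ = 2 * a + 5 * b + 2 * c →
      (B = 0 → A0 = 1 ∧ C1 = 1) ∧ (B = 1 → D = 1 → D' = 0 → A0 = 1)) := by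
  have hb : 0 < b := hc.trans hcb
  have k₁ := mul_le_mul_of_nonneg_left h₁ hb.le
  have k₂ := mul_le_mul_of_nonneg_left h₂ hb.le
  have k₃ := mul_le_mul_of_nonneg_left h₃ hb.le
  have k₄ := mul_le_mul_of_nonneg_left h₄ hc.le
  have k₅ := mul_le_mul_of_nonneg_left h₅ hc.le
  have l₃ := mul_le_mul_of_nonneg_left c₃ hb.le
  have l₄ := mul_le_mul_of_nonneg_left c₄ hb.le
  have l₅ := mul_le_mul_of_nonneg_left c₅ hb.le
  have l₆ := mul_le_mul_of_nonneg_left c₆ hc.le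
  have l₇ := mul_le_mul_of_nonneg_left c₇ hc.le
  constructor
  · rcases hA1 with rfl | rfl <;> rcases hB with rfl | rfl <;> rcases hD with rfl | rfl <;>
    rcases hD' with rfl | rfl <;> rcases hA0 with rfl | rfl <;> rcases hC1 with rfl | rfl <;>
    rcases hC2 with rfl | rfl <;> linarith
  · rintro rfl rfl rfl rfl rfl heq
    clear k₁ k₂ k₃ k₄ k₅ l₃ l₄ l₅ l₆ l₇ h₁ h₂ h₃ h₄ h₅
    rcases hA1 with rfl | rfl <;> rcases hB with rfl | rfl <;> rcases hD with rfl | rfl <;>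
    rcases hD' with rfl | rfl <;> rcases hA0 with rfl | rfl <;> rcases hC1 with rfl | rfl <;>
    rcases hC2 with rfl | rfl <;>
    first
    | exfalso; linarith
    | norm_num

/-- The weighted sets of the local inequality for `n = 3m + 1`. -/
def terms₁ (a b c : ℚ) : List (ℚ × Fin 3 × Finset (Fin 5)) :=
  [(-a, 0, {0, 1, 2}), (-b, 0, {0, 2}), (-b, 0, {1, 3, 4}), (-c, 0, {1, 2, 3, 4}),
    (-(a + b), 1, {3}), (-b, 2, {1, 4}), (-a, 2, {0, 1, 2, 3}),
    (-b, 2, {0, 2, 3}), (-b, 1, {0, 1, 2, 4}), (-b, 1, {1, 3}), (-c, 1, {2, 3}), (-c, 2, {1, 2, 4})]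

/-- The classes are meant to have sizes M, 1, 1, M+3, M+2. The four sets of role 0 then have sizes
m, m-1, 2m+2, 2m+3, the next three m+1, m+1, 2m+1, and the last five 2m or m+2. The two weights on
layer m+1 add up to a + 2b. -/
lemma local_one {a b c : ℚ} (hc : 0 < c) (hcb : c < b) (hba : b < a)
    {e : Fin 3 → Finset (Fin 5) → ℚ} (he : CrossVal e) :
    0 ≤ (2 * a + 5 * b + 2 * c) + ((terms₁ a b c).map fun t => t.1 * e t.2.1 t.2.2).sum ∧
    (e 2 {0, 2, 3} = 1 → e 1 {0, 1, 2, 4} = 1 → e 1 {1, 3} = 1 → e 1 {2, 3} = 1 →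
      e 2 {1, 2, 4} = 1 →
      (2 * a + 5 * b + 2 * c) + ((terms₁ a b c).map fun t => t.1 * e t.2.1 t.2.2).sum = 0 →
      (e 1 {3} = 0 → e 0 {0, 1, 2} = 1 ∧ e 0 {1, 3, 4} = 1) ∧
      (e 1 {3} = 1 → e 2 {1, 4} = 1 → e 2 {0, 1, 2, 3} = 0 → e 0 {0, 1, 2} = 1)) := by
  have h1 : ∀ i s, e i s ≤ 1 := fun i s => by
    rcases he.zero_or_one i s with h | h <;> rw [h] <;> norm_num
  have z := he.zero_or_one
  have c₁ := he.add_le 0 1 2 (by decide) (by decide) (by decide) {0, 1, 2} {3} (by decide)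
  have c₂ := he.add_le 1 2 0 (by decide) (by decide) (by decide) {3} {1, 4} (by decide)
  have c₃ := he.add_le 0 1 2 (by decide) (by decide) (by decide) {0, 2} {3} (by decide)
  have c₄ := he.add_le 0 2 1 (by decide) (by decide) (by decide) {0, 2} {1, 4} (by decide)
  have c₅ := he.add_le 0 1 2 (by decide) (by decide) (by decide) {0, 2} {1, 3} (by decide)
  have c₆ := he.add_le 1 2 0 (by decide) (by decide) (by decide) {3} {1, 2, 4} (by decide)
  have c₇ := he.add_le 2 1 0 (by decide) (by decide) (by decide) {1, 4} {2, 3} (by decide)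
  rw [show ({0, 1, 2} ∪ {3} : Finset (Fin 5)) = {0, 1, 2, 3} by decide] at c₁
  rw [show ({3} ∪ {1, 4} : Finset (Fin 5)) = {1, 3, 4} by decide] at c₂
  rw [show ({0, 2} ∪ {3} : Finset (Fin 5)) = {0, 2, 3} by decide] at c₃
  rw [show ({0, 2} ∪ {1, 4} : Finset (Fin 5)) = {0, 1, 2, 4} by decide] at c₄
  rw [show ({0, 2} ∪ {1, 3} : Finset (Fin 5)) = {0, 1, 2, 3} by decide] at c₅
  rw [show ({3} ∪ {1, 2, 4} : Finset (Fin 5)) = {1, 2, 3, 4} by decide] at c₆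
  rw [show ({1, 4} ∪ {2, 3} : Finset (Fin 5)) = {1, 2, 3, 4} by decide] at c₇
  obtain ⟨p, q⟩ := local_arith_one hc hcb hba (z 0 {0, 1, 2}) (z 0 {0, 2}) (z 0 {1, 3, 4})
    (z 0 {1, 2, 3, 4}) (z 1 {3}) (z 2 {1, 4}) (z 2 {0, 1, 2, 3}) (h1 2 {0, 2, 3})
    (h1 1 {0, 1, 2, 4}) (h1 1 {1, 3}) (h1 1 {2, 3}) (h1 2 {1, 2, 4}) c₁ c₂ c₃ c₄ c₅ c₆ c₇
  simp only [terms₁, List.map_cons, List.map_nil, List.sum_cons, List.sum_nil]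
  refine ⟨by linarith, fun g₁ g₂ g₃ g₄ g₅ heq => q g₁ g₂ g₃ g₄ g₅ (by linarith)⟩

/-- If Z = 1, then `c₁`, `c₃`, `c₅`, `c₆` bound X, Y, Xc, Yc by 1 - Ypc, 1 - Xpc, 1 - Yp, 1 - Xp. If
Z = 0, its weight 2 pays for Xc and Yc, and `c₂`, `c₄` charge X and Y to Yp, Xp and the two units of
Zc. -/
lemma local_arith_two_base {X Xc Y Yc Z Yp Xp Zc Ypc Xpc : ℚ}
    (hX : X ≤ 1) (hXc : Xc ≤ 1) (hY : Y ≤ 1) (hYc : Yc ≤ 1)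
    (hZ : Z = 0 ∨ Z = 1) (hYp : Yp = 0 ∨ Yp = 1) (hXp : Xp = 0 ∨ Xp = 1) (hZc : Zc = 0 ∨ Zc = 1)
    (hYpc : Ypc = 0 ∨ Ypc = 1) (hXpc : Xpc = 0 ∨ Xpc = 1)
    (c₁ : X + Z + Ypc ≤ 2) (c₂ : X + Yp + Zc ≤ 2) (c₃ : Y + Z + Xpc ≤ 2) (c₄ : Y + Xp + Zc ≤ 2)
    (c₅ : Z + Yp + Xc ≤ 2) (c₆ : Z + Xp + Yc ≤ 2) :
    X + Xc + Y + Yc + 2 * Z + Yp + Xp + 2 * Zc + Ypc + Xpc ≤ 8 := by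
  rcases hZ with rfl | rfl <;> rcases hYp with rfl | rfl <;> rcases hXp with rfl | rfl <;>
  rcases hZc with rfl | rfl <;> rcases hYpc with rfl | rfl <;> rcases hXpc with rfl | rfl <;>
  linarith

/-- By `c₁` and `c₂` the presence of X costs one of Z, Ypc and one of Yp, Zc, while `c₇` and `c₈`
allow at most two outer sets. As Z and Zc weigh 2, the loss stays at 2 only if Ypc and Yp are the
missing ones. -/
lemma local_arith_two_base_eq {X Xc Y Yc Z Yp Xp Zc Ypc Xpc : ℚ}
    (hZ : Z = 0 ∨ Z = 1) (hYp : Yp = 0 ∨ Yp = 1) (hXp : Xp = 0 ∨ Xp = 1) (hZc : Zc = 0 ∨ Zc = 1)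
    (hYpc : Ypc = 0 ∨ Ypc = 1) (hXpc : Xpc = 0 ∨ Xpc = 1) (hX : X = 1)
    (c₁ : X + Z + Ypc ≤ 2) (c₂ : X + Yp + Zc ≤ 2)
    (c₇ : X + Yc ≤ 1) (c₈ : Y + Xc ≤ 1)
    (heq : X + Xc + Y + Yc + 2 * Z + Yp + Xp + 2 * Zc + Ypc + Xpc = 8) : Z = 1 ∧ Yp = 0 := by
  rcases hZ with rfl | rfl <;> rcases hYp with rfl | rfl <;> rcases hXp with rfl | rfl <;>
  rcases hZc with rfl | rfl <;> rcases hYpc with rfl | rfl <;> rcases hXpc with rfl | rfl <;>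
  first
  | exfalso; linarith
  | norm_num

lemma CrossVal.le_one {r : ℕ} {e : Fin 3 → Finset (Fin r) → ℚ} (he : CrossVal e) (i : Fin 3)
    (s : Finset (Fin r)) : e i s ≤ 1 := by
  rcases he.zero_or_one i s with h | h <;> rw [h] <;> norm_num

lemma CrossVal.nonneg {r : ℕ} {e : Fin 3 → Finset (Fin r) → ℚ} (he : CrossVal e) (i : Fin 3)
    (s : Finset (Fin r)) : 0 ≤ e i s := by
  rcases he.zero_or_one i s with h | h <;> rw [h]; norm_num

lemma CrossVal.add_le' {r : ℕ} {e : Fin 3 → Finset (Fin r) → ℚ} (he : CrossVal e) (i j k : Fin 3)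
    (s t u : Finset (Fin r)) (h : (i ≠ j ∧ i ≠ k ∧ j ≠ k) ∧ Disjoint s t ∧ s ∪ t = u) :
    e i s + e j t + e k u ≤ 2 := by
  obtain ⟨⟨hij, hik, hjk⟩, hd, rfl⟩ := h
  exact he.add_le i j k hij hik hjk s t hd

/-- A set whose presence forces two valuations to vanish, unless one of some auxiliary sets is
missing, is either paid for by the latter or forces the former. -/
lemma paid_or_forced {b A P Q M N : ℚ} (hb : 0 < b) (hA : A = 0 ∨ A = 1) (hP : P = 0 ∨ P = 1)
    (hQ : Q = 0 ∨ Q = 1) (hM : M ≤ 1) (hN : N ≤ 1) (h₁ : A + P + M ≤ 2) (h₂ : A + Q + N ≤ 2) :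
    b * A ≤ b * (1 - M) + b * (1 - N) ∨ (P = 0 ∧ Q = 0) := by
  have k₁ := mul_nonneg hb.le (sub_nonneg.2 hM)
  have k₂ := mul_nonneg hb.le (sub_nonneg.2 hN)
  have l₁ := mul_le_mul_of_nonneg_left h₁ hb.le
  have l₂ := mul_le_mul_of_nonneg_left h₂ hb.le
  rcases hA with rfl | rfl <;> rcases hP with rfl | rfl <;> rcases hQ with rfl | rfl <;>
  first
  | (right; norm_num; done)
  | (left; linarith)

/-- In units of a, G is the gain on layers m, 2m+2 and C the loss on layers m+1, 2m+1; O is the gain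
on layers m-1, 2m+3 and M the loss on layers m+2, 2m. The claim is aG + O ≤ aC + M. Here G ≤ C by
`base`, and either M covers O, or an uncovered set of O empties enough sets counted in C for the
slack a(C - G) to outweigh the rest, as 2b < a. -/
lemma local_arith_two {a b X Xc Y Yc X' Xc' Y' Yc' Z Yp Xp Zc Ypc Xpc m₁ m₂ m₃ m₄ m₅ m₆ m₇ m₈ m₉ : ℚ}
    (hb : 0 < b) (hba : 2 * b < a)
    (base : X + Xc + Y + Yc + 2 * Z + Yp + Xp + 2 * Zc + Ypc + Xpc ≤ 8)
    (q₁ : b * X' ≤ b * (1 - m₁) + b * (1 - m₂) ∨ (Z = 0 ∧ Yp = 0))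
    (q₁' : b * X' ≤ b * (1 - m₅) + b * (1 - m₆) ∨ (Ypc = 0 ∧ Zc = 0))
    (q₂ : b * Y' ≤ b * (1 - m₃) + b * (1 - m₄) ∨ (Z = 0 ∧ Xp = 0))
    (q₂' : b * Y' ≤ b * (1 - m₇) + b * (1 - m₈) ∨ (Xpc = 0 ∧ Zc = 0))
    (q₃ : b * Xc' ≤ b * (1 - m₅) + b * (1 - m₆) ∨ (Yp = 0 ∧ Z = 0))
    (q₄ : b * Yc' ≤ b * (1 - m₇) + b * (1 - m₈) ∨ (Xp = 0 ∧ Z = 0))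
    (fX : X ≤ 1) (fXc : Xc ≤ 1) (fY : Y ≤ 1) (fYc : Yc ≤ 1) (fX' : X' ≤ 1) (fXc' : Xc' ≤ 1)
    (fY' : Y' ≤ 1) (fYc' : Yc' ≤ 1) (fYp : Yp ≤ 1) (fXp : Xp ≤ 1) (fZc : Zc ≤ 1)
    (fYpc : Ypc ≤ 1) (fXpc : Xpc ≤ 1) (f₁ : m₁ ≤ 1) (f₂ : m₂ ≤ 1) (f₃ : m₃ ≤ 1) (f₄ : m₄ ≤ 1)
    (f₅ : m₅ ≤ 1) (f₆ : m₆ ≤ 1) (f₇ : m₇ ≤ 1) (f₈ : m₈ ≤ 1) (f₉ : m₉ = 0 ∨ m₉ = 1)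
    (pX' : 0 ≤ X') (pXc' : 0 ≤ Xc') (pY' : 0 ≤ Y') (pYc' : 0 ≤ Yc')
    (c₅ : Z + Yp + Xc ≤ 2) (c₆ : Z + Xp + Yc ≤ 2) (c₇ : X + m₉ + Yc ≤ 2) (c₈ : Y + m₉ + Xc ≤ 2)
    (base_eq : X = 1 → X + Yc ≤ 1 → Y + Xc ≤ 1 →
      X + Xc + Y + Yc + 2 * Z + Yp + Xp + 2 * Zc + Ypc + Xpc = 8 → Z = 1 ∧ Yp = 0) :
    0 ≤ 8 * a + 14 * b + (-a * X + (-a * Xc + (-a * Y + (-a * Yc + (-b * X' + (-b * Xc' + (-b * Y' +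
      (-b * Yc' + (-(2 * a) * Z + (-a * Yp + (-a * Xp + (-(2 * a) * Zc + (-a * Ypc + (-a * Xpc +
      (-b * m₁ + (-b * m₂ + (-b * m₃ + (-b * m₄ + (-(2 * b) * m₅ + (-(2 * b) * m₆ +
      (-(2 * b) * m₇ + (-(2 * b) * m₈ + (-(2 * b) * m₉ + 0))))))))))))))))))))))) ∧
    (m₁ = 1 → m₂ = 1 → m₃ = 1 → m₄ = 1 → m₅ = 1 → m₆ = 1 → m₇ = 1 → m₈ = 1 → m₉ = 1 →
      8 * a + 14 * b + (-a * X + (-a * Xc + (-a * Y + (-a * Yc + (-b * X' + (-b * Xc' + (-b * Y' +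
      (-b * Yc' + (-(2 * a) * Z + (-a * Yp + (-a * Xp + (-(2 * a) * Zc + (-a * Ypc + (-a * Xpc +
      (-b * m₁ + (-b * m₂ + (-b * m₃ + (-b * m₄ + (-(2 * b) * m₅ + (-(2 * b) * m₆ +
      (-(2 * b) * m₇ + (-(2 * b) * m₈ + (-(2 * b) * m₉ + 0))))))))))))))))))))))) = 0 →
      X' = 0 ∧ Xc' = 0 ∧ (X = 1 → Z = 1 ∧ Yp = 0) ∧ (X = 0 → Y = 0 → Xc = (1 - Z) + (1 - Yp) ∧ Zc = 1)) := by
  have ha : 0 < a := by linarith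
  set G := X + Xc + Y + Yc with hG
  set C := 2 * (1 - Z) + (1 - Yp) + (1 - Xp) + 2 * (1 - Zc) + (1 - Ypc) + (1 - Xpc) with hC
  set O := b * X' + b * Y' + b * Xc' + b * Yc' with hO
  set M := b * (1 - m₁) + b * (1 - m₂) + b * (1 - m₃) + b * (1 - m₄) +
    2 * (b * (1 - m₅) + b * (1 - m₆) + b * (1 - m₇) + b * (1 - m₈) + b * (1 - m₉)) with hM
  have n₁ := mul_nonneg hb.le (sub_nonneg.2 f₁)
  have n₂ := mul_nonneg hb.le (sub_nonneg.2 f₂)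
  have n₃ := mul_nonneg hb.le (sub_nonneg.2 f₃)
  have n₄ := mul_nonneg hb.le (sub_nonneg.2 f₄)
  have n₅ := mul_nonneg hb.le (sub_nonneg.2 f₅)
  have n₆ := mul_nonneg hb.le (sub_nonneg.2 f₆)
  have n₇ := mul_nonneg hb.le (sub_nonneg.2 f₇)
  have n₈ := mul_nonneg hb.le (sub_nonneg.2 f₈)
  have n₉ : 0 ≤ b * (1 - m₉) := mul_nonneg hb.le (by rcases f₉ with h | h <;> rw [h] <;> norm_num)
  have hGC : G ≤ C := by linarith
  have o₁ := mul_le_mul_of_nonneg_left fX' hb.le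
  have o₂ := mul_le_mul_of_nonneg_left fY' hb.le
  have o₃ := mul_le_mul_of_nonneg_left fXc' hb.le
  have o₄ := mul_le_mul_of_nonneg_left fYc' hb.le
  have key : O ≤ M ∨ G + 2 ≤ C ∧ O < 2 * a ∨ G + 1 ≤ C ∧ O < M + a ∧ m₉ = 1 := by
    by_cases hX : b * X' ≤ b * (1 - m₁) + b * (1 - m₂) + b * (1 - m₅) + b * (1 - m₆)
    swap
    -- An unpaid X' empties Z, Yp, Ypc and Zc, so C ≥ 6 while G ≤ 4 and O ≤ 4b.
    · obtain ⟨hz, hyp⟩ := q₁.resolve_left fun h => hX (by linarith)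
      obtain ⟨hypc, hzc⟩ := q₁'.resolve_left fun h => hX (by linarith)
      right; left
      constructor <;> linarith
    by_cases hY : b * Y' ≤ b * (1 - m₃) + b * (1 - m₄) + b * (1 - m₇) + b * (1 - m₈)
    swap
    · obtain ⟨hz, hyp⟩ := q₂.resolve_left fun h => hY (by linarith)
      obtain ⟨hypc, hzc⟩ := q₂'.resolve_left fun h => hY (by linarith)
      right; left
      constructor <;> linarith
    -- A missing m₉ pays 2b, enough for Xc' and Yc' together. If m₉ = 1, then G ≤ 2 by `c₇` and
    -- `c₈`, whereas an unpaid Xc' or Yc' gives C ≥ 3 and O ≤ M + 2b.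
    rcases f₉ with h9 | h9
    · left
      rw [h9] at hM
      rcases q₃ with q₃ | ⟨hyp, hz⟩ <;> rcases q₄ with q₄ | ⟨hxp, hz⟩ <;> linarith
    · rw [h9] at c₇ c₈
      rcases q₃ with q₃ | ⟨hyp, hz⟩
      · rcases q₄ with q₄ | ⟨hxp, hz⟩
        · left; linarith
        · right; right
          exact ⟨by linarith, by linarith, h9⟩
      · right; right
        exact ⟨by linarith, by linarith, h9⟩
  have haGC := mul_le_mul_of_nonneg_left hGC ha.le
  have main : a * G + O ≤ a * C + M := by
    rcases key with h | ⟨h, h'⟩ | ⟨h, h', -⟩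
    · linarith
    · have := mul_le_mul_of_nonneg_left h ha.le
      linarith
    · have := mul_le_mul_of_nonneg_left h ha.le
      linarith
  constructor
  · linarith
  · intro e₁ e₂ e₃ e₄ e₅ e₆ e₇ e₈ e₉ heq
    have hM0 : M = 0 := by rw [hM, e₁, e₂, e₃, e₄, e₅, e₆, e₇, e₈, e₉]; ring
    have heq' : a * G + O = a * C := by
      have : a * G + O = a * C + M := by linarith
      rw [this, hM0, add_zero]
    have p₁ := mul_nonneg hb.le pX'
    have p₂ := mul_nonneg hb.le pXc'
    have p₃ := mul_nonneg hb.le pY'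
    have p₄ := mul_nonneg hb.le pYc'
    have hO0 : O = 0 := by
      rcases key with h | ⟨h, h'⟩ | ⟨h, h', -⟩
      · linarith
      · have := mul_le_mul_of_nonneg_left h ha.le
        linarith
      · have := mul_le_mul_of_nonneg_left h ha.le
        linarith
    have hCG : G = C := mul_left_cancel₀ ha.ne' (by linarith)
    rw [e₉] at c₇ c₈
    refine ⟨(mul_eq_zero.1 (show b * X' = 0 by linarith)).resolve_left hb.ne',
      (mul_eq_zero.1 (show b * Xc' = 0 by linarith)).resolve_left hb.ne', fun h => base_eq h (by linarith) (by linarith) (by linarith), fun hx hy => ?_⟩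
    -- With X = Y = 0 the bounds `c₅` and `c₆` on Xc and Yc add up to only a part of C; G = C makes
    -- both tight and the rest of C zero.
    constructor <;> linarith

/-- The weighted sets of the local inequality for `n = 3m + 2`. -/
def terms₂ (a b : ℚ) : List (ℚ × Fin 3 × Finset (Fin 6)) :=
  [(-a, 0, {0, 1}), (-a, 0, {2, 3, 4, 5}), (-a, 2, {2, 3}), (-a, 2, {0, 1, 4, 5}),
    (-b, 0, {0}), (-b, 0, {1, 2, 3, 4, 5}), (-b, 2, {2}), (-b, 2, {0, 1, 3, 4, 5}),
    (-(2 * a), 1, {4}), (-a, 2, {2, 3, 5}), (-a, 0, {0, 1, 5}),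
    (-(2 * a), 1, {0, 1, 2, 3, 5}), (-a, 2, {0, 1, 4}), (-a, 0, {2, 3, 4}),
    (-b, 2, {0, 4}), (-b, 1, {0, 2, 3, 5}), (-b, 0, {2, 4}), (-b, 1, {0, 1, 2, 5}),
    (-(2 * b), 1, {1, 4}), (-(2 * b), 2, {1, 2, 3, 5}),
    (-(2 * b), 1, {3, 4}), (-(2 * b), 0, {0, 1, 3, 5}), (-(2 * b), 1, {4, 5})]

/-- The classes are meant to have sizes M+1, 1, M+1, 1, M+3, 1. In the letters of `local_arith_two`,
X, Y, Z are {0, 1}, {2, 3}, {4} in roles 0, 2, 1; p adjoins class 5, a prime drops the single point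
1 or 3, and c takes the complement. -/
lemma local_two {a b : ℚ} (hb : 0 < b) (hba : 2 * b < a)
    {e : Fin 3 → Finset (Fin 6) → ℚ} (he : CrossVal e) :
    0 ≤ (8 * a + 14 * b) + ((terms₂ a b).map fun t => t.1 * e t.2.1 t.2.2).sum ∧
    (e 2 {0, 4} = 1 → e 1 {0, 2, 3, 5} = 1 → e 0 {2, 4} = 1 → e 1 {0, 1, 2, 5} = 1 →
      e 1 {1, 4} = 1 → e 2 {1, 2, 3, 5} = 1 → e 1 {3, 4} = 1 → e 0 {0, 1, 3, 5} = 1 →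
      e 1 {4, 5} = 1 →
      (8 * a + 14 * b) + ((terms₂ a b).map fun t => t.1 * e t.2.1 t.2.2).sum = 0 →
      e 0 {0} = 0 ∧ e 0 {1, 2, 3, 4, 5} = 0 ∧ (e 0 {0, 1} = 1 → e 1 {4} = 1 ∧ e 2 {2, 3, 5} = 0) ∧
      (e 0 {0, 1} = 0 → e 2 {2, 3} = 0 →
        e 0 {2, 3, 4, 5} = (1 - e 1 {4}) + (1 - e 2 {2, 3, 5}) ∧ e 1 {0, 1, 2, 3, 5} = 1)) := by
  have z := he.zero_or_one
  have g := he.le_one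
  have p := he.nonneg
  have c₁ := he.add_le' 0 1 2 {0, 1} {4} {0, 1, 4} (by decide)
  have c₂ := he.add_le' 0 2 1 {0, 1} {2, 3, 5} {0, 1, 2, 3, 5} (by decide)
  have c₃ := he.add_le' 2 1 0 {2, 3} {4} {2, 3, 4} (by decide)
  have c₄ := he.add_le' 2 0 1 {2, 3} {0, 1, 5} {0, 1, 2, 3, 5} (by decide)
  have c₅ := he.add_le' 1 2 0 {4} {2, 3, 5} {2, 3, 4, 5} (by decide)
  have c₆ := he.add_le' 1 0 2 {4} {0, 1, 5} {0, 1, 4, 5} (by decide)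
  have c₇ := he.add_le' 0 1 2 {0, 1} {4, 5} {0, 1, 4, 5} (by decide)
  have c₈ := he.add_le' 2 1 0 {2, 3} {4, 5} {2, 3, 4, 5} (by decide)
  have base := local_arith_two_base (g 0 {0, 1}) (g 0 {2, 3, 4, 5}) (g 2 {2, 3})
    (g 2 {0, 1, 4, 5}) (z 1 {4}) (z 2 {2, 3, 5}) (z 0 {0, 1, 5}) (z 1 {0, 1, 2, 3, 5})
    (z 2 {0, 1, 4}) (z 0 {2, 3, 4}) c₁ c₂ c₃ c₄ c₅ c₆
  have q₁ := paid_or_forced hb (z 0 {0}) (z 1 {4}) (z 2 {2, 3, 5}) (g 2 {0, 4})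
    (g 1 {0, 2, 3, 5}) (he.add_le' 0 1 2 {0} {4} {0, 4} (by decide))
    (he.add_le' 0 2 1 {0} {2, 3, 5} {0, 2, 3, 5} (by decide))
  have q₁' := paid_or_forced hb (z 0 {0}) (z 2 {0, 1, 4}) (z 1 {0, 1, 2, 3, 5}) (g 1 {1, 4})
    (g 2 {1, 2, 3, 5}) (by linarith [he.add_le' 0 1 2 {0} {1, 4} {0, 1, 4} (by decide)])
    (by linarith [he.add_le' 0 2 1 {0} {1, 2, 3, 5} {0, 1, 2, 3, 5} (by decide)])
  have q₂ := paid_or_forced hb (z 2 {2}) (z 1 {4}) (z 0 {0, 1, 5}) (g 0 {2, 4})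
    (g 1 {0, 1, 2, 5}) (he.add_le' 2 1 0 {2} {4} {2, 4} (by decide))
    (he.add_le' 2 0 1 {2} {0, 1, 5} {0, 1, 2, 5} (by decide))
  have q₂' := paid_or_forced hb (z 2 {2}) (z 0 {2, 3, 4}) (z 1 {0, 1, 2, 3, 5}) (g 1 {3, 4})
    (g 0 {0, 1, 3, 5}) (by linarith [he.add_le' 2 1 0 {2} {3, 4} {2, 3, 4} (by decide)])
    (by linarith [he.add_le' 2 0 1 {2} {0, 1, 3, 5} {0, 1, 2, 3, 5} (by decide)])
  have q₃ := paid_or_forced hb (z 0 {1, 2, 3, 4, 5}) (z 2 {2, 3, 5}) (z 1 {4}) (g 1 {1, 4})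
    (g 2 {1, 2, 3, 5}) (by linarith [he.add_le' 2 1 0 {2, 3, 5} {1, 4} {1, 2, 3, 4, 5} (by decide)])
    (by linarith [he.add_le' 1 2 0 {4} {1, 2, 3, 5} {1, 2, 3, 4, 5} (by decide)])
  have q₄ := paid_or_forced hb (z 2 {0, 1, 3, 4, 5}) (z 0 {0, 1, 5}) (z 1 {4}) (g 1 {3, 4})
    (g 0 {0, 1, 3, 5}) (by linarith [he.add_le' 0 1 2 {0, 1, 5} {3, 4} {0, 1, 3, 4, 5} (by decide)])
    (by linarith [he.add_le' 1 0 2 {4} {0, 1, 3, 5} {0, 1, 3, 4, 5} (by decide)])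
  simp only [terms₂, List.map_cons, List.map_nil, List.sum_cons, List.sum_nil]
  have fX := g 0 {0, 1}
  have fXc := g 0 {2, 3, 4, 5}
  have fY := g 2 {2, 3}
  have fYc := g 2 {0, 1, 4, 5}
  have fX' := g 0 {0}
  have fXc' := g 0 {1, 2, 3, 4, 5}
  have fY' := g 2 {2}
  have fYc' := g 2 {0, 1, 3, 4, 5}
  have fYp := g 2 {2, 3, 5}
  have fXp := g 0 {0, 1, 5}
  have fZc := g 1 {0, 1, 2, 3, 5}
  have fYpc := g 2 {0, 1, 4}
  have fXpc := g 0 {2, 3, 4}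
  have f₁ := g 2 {0, 4}
  have f₂ := g 1 {0, 2, 3, 5}
  have f₃ := g 0 {2, 4}
  have f₄ := g 1 {0, 1, 2, 5}
  have f₅ := g 1 {1, 4}
  have f₆ := g 2 {1, 2, 3, 5}
  have f₇ := g 1 {3, 4}
  have f₈ := g 0 {0, 1, 3, 5}
  have f₉ := z 1 {4, 5}
  have pX' := p 0 {0}
  have pXc' := p 0 {1, 2, 3, 4, 5}
  have pY' := p 2 {2}
  have pYc' := p 2 {0, 1, 3, 4, 5}
  have pXc := p 0 {2, 3, 4, 5}
  have pYc := p 2 {0, 1, 4, 5}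
  have base_eq := fun h : e 0 {0, 1} = 1 => local_arith_two_base_eq (Xc := e 0 {2, 3, 4, 5})
    (Y := e 2 {2, 3}) (z 1 {4}) (z 2 {2, 3, 5}) (z 0 {0, 1, 5}) (z 1 {0, 1, 2, 3, 5})
    (z 2 {0, 1, 4}) (z 0 {2, 3, 4}) h c₁ c₂ (Yc := e 2 {0, 1, 4, 5})
  clear z g p c₁ c₂ c₃ c₄ he
  generalize e 0 {0, 1} = X at *
  generalize e 0 {2, 3, 4, 5} = Xc at *
  generalize e 2 {2, 3} = Y at *
  generalize e 2 {0, 1, 4, 5} = Yc at *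
  generalize e 0 {0} = X' at *
  generalize e 0 {1, 2, 3, 4, 5} = Xc' at *
  generalize e 2 {2} = Y' at *
  generalize e 2 {0, 1, 3, 4, 5} = Yc' at *
  generalize e 1 {4} = Z at *
  generalize e 2 {2, 3, 5} = Yp at *
  generalize e 0 {0, 1, 5} = Xp at *
  generalize e 1 {0, 1, 2, 3, 5} = Zc at *
  generalize e 2 {0, 1, 4} = Ypc at *
  generalize e 0 {2, 3, 4} = Xpc at *
  generalize e 2 {0, 4} = m₁ at *
  generalize e 1 {0, 2, 3, 5} = m₂ at *
  generalize e 0 {2, 4} = m₃ at *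
  generalize e 1 {0, 1, 2, 5} = m₄ at *
  generalize e 1 {1, 4} = m₅ at *
  generalize e 2 {1, 2, 3, 5} = m₆ at *
  generalize e 1 {3, 4} = m₇ at *
  generalize e 0 {0, 1, 3, 5} = m₈ at *
  generalize e 1 {4, 5} = m₉ at *
  exact local_arith_two hb hba base q₁ q₁' q₂ q₂' q₃ q₄ fX fXc fY fYc fX' fXc' fY' fYc' fYp fXp
    fZc fYpc fXpc f₁ f₂ f₃ f₄ f₅ f₆ f₇ f₈ f₉ pX' pXc' pY' pYc' c₅ c₆ c₇ c₈ base_eq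

/-! ### Realising prescribed sets as unions of colour classes -/

lemma exists_perm_comp_eq {n q : ℕ} {f g : Fin n → Fin q}
    (h : ∀ j, (univ.filter fun x => f x = j).card = (univ.filter fun x => g x = j).card) :
    ∃ τ : Equiv.Perm (Fin n), f ∘ τ = g := by
  have e : ∀ j, {x // g x = j} ≃ {x // f x = j} := fun j =>
    Fintype.equivOfCardEq (by rw [Fintype.card_subtype, Fintype.card_subtype, h j])
  refine ⟨(Equiv.sigmaFiberEquiv g).symm.trans ((Equiv.sigmaCongrRight e).trans
    (Equiv.sigmaFiberEquiv f)), ?_⟩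
  ext x
  simp only [Function.comp_apply, Equiv.trans_apply]
  have := (e (g x) ⟨x, rfl⟩).2
  exact congrArg Fin.val this

/-- A disjoint pair is determined up to a permutation of the points by its two sizes, and such a
permutation transports any colouring of the type. This lets the equality conditions be applied to
prescribed sets. -/
lemma exists_coloring {n r : ℕ} (k : Fin r → ℕ) (hk : ∑ i, k i = n) {s t : Finset (Fin r)}
    (hst : Disjoint s t) {S T : Finset (Fin n)} (hST : Disjoint S T)
    (hS : S.card = ∑ i ∈ s, k i) (hT : T.card = ∑ i ∈ t, k i) :
    ∃ c ∈ colorings n k, colorUnion c s = S ∧ colorUnion c t = T := by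
  obtain ⟨c₀, hc₀⟩ := colorings_nonempty k hk
  have hs := card_colorUnion hc₀ s
  have ht := card_colorUnion hc₀ t
  have hd := disjoint_colorUnion c₀ hst
  set S₀ := colorUnion c₀ s with hS₀
  set T₀ := colorUnion c₀ t with hT₀
  have aux : ∀ (S T : Finset (Fin n)), Disjoint S T → ∀ j : Fin 3,
      (univ.filter fun x => (if x ∈ S then 0 else if x ∈ T then 1 else 2 : Fin 3) = j).card =
      ![S.card, T.card, n - (S.card + T.card)] j := by
    intro S T hST j
    have h0 : ∀ x, (if x ∈ S then 0 else if x ∈ T then 1 else 2 : Fin 3) = 0 ↔ x ∈ S := by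
      intro x; split_ifs <;> simp_all
    have h1 : ∀ x, (if x ∈ S then 0 else if x ∈ T then 1 else 2 : Fin 3) = 1 ↔ x ∈ T := by
      intro x; split_ifs with h h' <;> simp_all
      exact fun h' => (Finset.disjoint_left.1 hST h h')
    have h2 : ∀ x, (if x ∈ S then 0 else if x ∈ T then 1 else 2 : Fin 3) = 2 ↔ x ∈ (S ∪ T)ᶜ := by
      intro x; split_ifs with h h' <;> simp_all
    fin_cases j
    · simp [h0]
    · simp [h1]
    · simp only [Fin.reduceFinMk, h2]
      rw [filter_mem_eq_inter, univ_inter, card_compl, card_union_of_disjoint hST]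
      simp
  obtain ⟨τ, hτ⟩ := exists_perm_comp_eq
    (f := fun x => (if x ∈ S₀ then 0 else if x ∈ T₀ then 1 else 2 : Fin 3))
    (g := fun x => (if x ∈ S then 0 else if x ∈ T then 1 else 2 : Fin 3))
    (fun j => by rw [aux _ _ hd, aux _ _ hST, hs, ht, hS, hT])
  have hτS : ∀ x, τ x ∈ S₀ ↔ x ∈ S := by
    intro x
    have := congrFun hτ x
    simp only [Function.comp_apply] at this
    by_cases h1 : τ x ∈ S₀ <;> by_cases h2 : x ∈ S <;> simp [h1, h2] at this ⊢ <;>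
    · split_ifs at this <;> simp at this
  have hτT : ∀ x, τ x ∈ T₀ ↔ x ∈ T := by
    intro x
    have := congrFun hτ x
    have hd1 : τ x ∈ S₀ → τ x ∉ T₀ := fun h => Finset.disjoint_left.1 hd h
    have hd2 : x ∈ S → x ∉ T := fun h => Finset.disjoint_left.1 hST h
    simp only [Function.comp_apply] at this
    have h3 := hτS x
    by_cases h4 : x ∈ S
    · have := h3.2 h4
      exact iff_of_false (hd1 this) (hd2 h4)
    · have h5 : τ x ∉ S₀ := fun h => h4 (h3.1 h)
      simp only [h4, h5, if_false] at this
      by_cases h1 : τ x ∈ T₀ <;> by_cases h2 : x ∈ T <;> simp [h1, h2] at this ⊢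
  refine ⟨c₀ ∘ τ, ?_, ?_, ?_⟩
  · simp only [colorings, mem_filter, mem_univ, true_and] at hc₀ ⊢
    intro i
    rw [← hc₀ i]
    exact Finset.card_bij' (fun x _ => τ x) (fun x _ => τ.symm x) (by simp) (by simp) (by simp)
      (by simp)
  · ext x
    rw [← hτS x]; simp [S₀, colorUnion]
  · ext x
    rw [← hτT x]; simp [T₀, colorUnion]

/-! ### Densities -/

lemma card_layer {n : ℕ} (t : ℕ) :
    (univ.filter fun S : Finset (Fin n) => S.card = t).card = n.choose t := by
  rw [← Finset.powerset_univ, ← Finset.powersetCard_eq_filter]; simp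

lemma density_nonneg {n : ℕ} (F : Finset (Finset (Fin n))) (t : ℕ) : 0 ≤ density F t := by
  unfold density; positivity

lemma card_filter_layer_le {n : ℕ} (F : Finset (Finset (Fin n))) (t : ℕ) :
    (F.filter fun S => S.card = t).card ≤ n.choose t := by
  rw [← card_layer]
  exact card_le_card (filter_subset_filter _ (subset_univ _))

lemma density_le_one {n : ℕ} (F : Finset (Finset (Fin n))) (t : ℕ) : density F t ≤ 1 := by
  unfold density
  exact div_le_one_of_le₀ (by exact_mod_cast card_filter_layer_le F t) (by positivity)

/-- For t > n the density is 0 / 0 = 0, so no bound on t is needed. -/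
lemma choose_mul_density {n : ℕ} (F : Finset (Finset (Fin n))) (t : ℕ) :
    (n.choose t : ℚ) * density F t = (F.filter fun S => S.card = t).card := by
  unfold density
  rcases Nat.eq_zero_or_pos (n.choose t) with h | h
  · have := card_filter_layer_le F t
    have h0 : (F.filter fun S => S.card = t).card = 0 := Nat.le_zero.1 (this.trans h.le)
    rw [h0, h]
    simp
  · field_simp

lemma density_eq_one {n : ℕ} {F : Finset (Finset (Fin n))} {S : Finset (Fin n)}
    (h : density F S.card = 1) : S ∈ F := by
  have h1 := choose_mul_density F S.card
  rw [h, mul_one, ← card_layer] at h1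
  have h2 : (F.filter fun T => T.card = S.card) = univ.filter fun T => T.card = S.card :=
    eq_of_subset_of_card_le (filter_subset_filter _ (subset_univ _)) (by exact_mod_cast h1.le)
  have h3 : S ∈ F.filter fun T => T.card = S.card := by rw [h2]; simp
  exact (mem_filter.1 h3).1

lemma density_eq_zero {n : ℕ} {F : Finset (Finset (Fin n))} {S : Finset (Fin n)}
    (h : density F S.card = 0) : S ∉ F := by
  intro hS
  have h1 := choose_mul_density F S.card
  rw [h, mul_zero, eq_comm] at h1
  have h2 : (F.filter fun T => T.card = S.card).card = 0 := by exact_mod_cast h1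
  rw [card_eq_zero] at h2
  exact (eq_empty_iff_forall_notMem.1 h2) S (by simp [hS])

lemma card_eq_sum_density {n : ℕ} (F : Finset (Finset (Fin n))) :
    (F.card : ℚ) = ∑ t ∈ range (n + 1), (n.choose t : ℚ) * density F t := by
  simp only [choose_mul_density]
  rw [← Nat.cast_sum, ← card_eq_sum_card_fiberwise]
  intro S _
  have := card_le_univ S
  simp at this ⊢
  omega

lemma totalDensity_nonneg {n : ℕ} (F : Fin 3 → Finset (Finset (Fin n))) (t : ℕ) :
    0 ≤ totalDensity F t := Finset.sum_nonneg fun _ _ => density_nonneg _ _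

lemma totalDensity_le {n : ℕ} (F : Fin 3 → Finset (Finset (Fin n))) (t : ℕ) :
    totalDensity F t ≤ 3 := by
  have := Finset.sum_le_sum fun i (_ : i ∈ (univ : Finset (Fin 3))) => density_le_one (F i) t
  simpa [totalDensity] using this

lemma mem_of_totalDensity {n : ℕ} {F : Fin 3 → Finset (Finset (Fin n))} {S : Finset (Fin n)}
    (h : totalDensity F S.card = 3) (i : Fin 3) : S ∈ F i := by
  apply density_eq_one
  simp only [totalDensity, Fin.sum_univ_three] at h
  have h0 := density_le_one (F 0) S.card
  have h1 := density_le_one (F 1) S.card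
  have h2 := density_le_one (F 2) S.card
  fin_cases i <;> simp <;> linarith

lemma notMem_of_totalDensity {n : ℕ} {F : Fin 3 → Finset (Finset (Fin n))} {S : Finset (Fin n)}
    (h : totalDensity F S.card = 0) (i : Fin 3) : S ∉ F i := by
  apply density_eq_zero
  simp only [totalDensity, Fin.sum_univ_three] at h
  have h0 := density_nonneg (F 0) S.card
  have h1 := density_nonneg (F 1) S.card
  have h2 := density_nonneg (F 2) S.card
  fin_cases i <;> simp <;> linarith

lemma sum_card_eq_sum_totalDensity {n : ℕ} (F : Fin 3 → Finset (Finset (Fin n))) :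
    (((F 0).card + (F 1).card + (F 2).card : ℕ) : ℚ) =
      ∑ t ∈ range (n + 1), (n.choose t : ℚ) * totalDensity F t := by
  push_cast
  rw [card_eq_sum_density, card_eq_sum_density, card_eq_sum_density, ← sum_add_distrib,
    ← sum_add_distrib]
  refine sum_congr rfl fun t _ => ?_
  rw [totalDensity, Fin.sum_univ_three]; ring

/-- This averages the defining constraint over three-class colourings. It serves the far outer
layers, as s or as s + t, the other two sizes being inner. -/
lemma CrossFree.totalDensity_add_le {n : ℕ} {F : Fin 3 → Finset (Finset (Fin n))}
    (h : CrossFree F) {s t : ℕ} (hst : s + t ≤ n) :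
    totalDensity F s + totalDensity F t + totalDensity F (s + t) ≤ 6 := by
  have := (affine_density ![s, t, n - (s + t)] (by simp [Fin.sum_univ_three]; omega) F 2
    [(-1, 0, {0}), (-1, 1, {1}), (-1, 2, {0, 1})] fun ρ c => by
      have := (h.crossVal ρ c).add_le 0 1 2 (by decide) (by decide) (by decide) {0} {1}
        (by decide)
      rw [show ({0} ∪ {1} : Finset (Fin 3)) = {0, 1} by decide] at this
      simp only [List.map_cons, List.map_nil, List.sum_cons, List.sum_nil]
      linarith).1
  simp at this
  linarith

/-! ### Binomial coefficients -/

lemma succ_mul_choose_rat (n t : ℕ) (h : t ≤ n) :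
    ((t : ℚ) + 1) * (n.choose (t + 1) : ℚ) = ((n : ℚ) - t) * n.choose t := by
  have := Nat.choose_succ_right_eq n t
  rw [← Nat.cast_sub h]
  have h2 : ((n.choose (t + 1) * (t + 1) : ℕ) : ℚ) = ((n.choose t * (n - t) : ℕ) : ℚ) := by rw [this]
  push_cast at h2
  linarith

lemma choose_le_choose_of_add_le {n a t : ℕ} (h₁ : a ≤ t) (h₂ : a + t ≤ n) :
    n.choose a ≤ n.choose t := by
  have key : ∀ b, a ≤ b → b ≤ n / 2 → n.choose a ≤ n.choose b := by
    intro b hab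
    induction b, hab using Nat.le_induction with
    | base => intro _; exact le_rfl
    | succ b _ ih =>
      intro hb
      exact (ih (by omega)).trans (Nat.choose_le_succ_of_lt_half_left (by omega))
  by_cases ht : t ≤ n / 2
  · exact key t h₁ ht
  · rw [← Nat.choose_symm (show t ≤ n by omega)]
    exact key _ (by omega) (by omega)

lemma two_mul_choose_le {n t : ℕ} (h : 3 * t + 2 ≤ n) :
    2 * (n.choose t : ℚ) ≤ n.choose (t + 1) := by
  have h1 := succ_mul_choose_rat n t (by omega)
  have h2 : (3 * t + 2 : ℚ) ≤ n := by exact_mod_cast h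
  have h3 : (0 : ℚ) ≤ n.choose t := by positivity
  have h4 : ((t : ℚ) + 1) * (2 * n.choose t) ≤ ((t : ℚ) + 1) * n.choose (t + 1) := by
    rw [h1]; nlinarith
  exact le_of_mul_le_mul_left h4 (by positivity)

/-- Up to layer q the binomials at least double at each step, so a geometric series dominates; the
induction carries the last term twice. The bound on k keeps q - i from being truncated. -/
lemma sum_choose_sub_le {n q : ℕ} (h : 3 * q ≤ n + 1) {k : ℕ} (hk : k ≤ q + 1) :
    ∑ i ∈ range k, (n.choose (q - i) : ℚ) ≤ 2 * n.choose q := by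
  rcases k with _ | k
  · simp
  have key : ∀ k ≤ q, ∑ i ∈ range (k + 1), (n.choose (q - i) : ℚ) + n.choose (q - k) ≤
      2 * n.choose q := by
    intro k
    induction k with
    | zero => intro _; simp; linarith
    | succ k ih =>
      intro hk
      rw [sum_range_succ]
      have h1 := ih (by omega)
      have h2 := two_mul_choose_le (n := n) (t := q - (k + 1)) (by omega)
      rw [show q - (k + 1) + 1 = q - k by omega] at h2
      linarith
  have := key k (by omega)
  have h2 : (0 : ℚ) ≤ n.choose (q - k) := by positivity
  linarith

/-! ### Summation over layers -/

/-- E i is the loss on an inner layer, g i the weight available there; α and β are the extra charges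
on the last and the first of these layers, which add up when k = 0. Strictness in `hg` yields the
equality statement. -/
lemma sum_with_endpoints {k : ℕ} {g E : ℕ → ℚ} {α β : ℚ} (hE : ∀ i, 0 ≤ E i)
    (hg : ∀ i ≤ k, (if i = k then α else 0) + (if i = 0 then β else 0) < g i) :
    α * E k + β * E 0 ≤ ∑ i ∈ range (k + 1), g i * E i ∧
    (∑ i ∈ range (k + 1), g i * E i ≤ α * E k + β * E 0 → ∀ i ≤ k, E i = 0) := by
  have h1 : ∑ i ∈ range (k + 1), g i * E i - (α * E k + β * E 0) =
      ∑ i ∈ range (k + 1),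
        (g i - ((if i = k then α else 0) + (if i = 0 then β else 0))) * E i := by
    simp only [sub_mul, add_mul, sum_sub_distrib, sum_add_distrib, ite_mul, zero_mul]
    rw [sum_ite_eq', sum_ite_eq']
    simp
  have hnn : ∀ i ∈ range (k + 1),
      0 ≤ (g i - ((if i = k then α else 0) + (if i = 0 then β else 0))) * E i := by
    intro i hi
    exact mul_nonneg (sub_nonneg.2 (hg i (by simp at hi; omega)).le) (hE i)
  constructor
  · have := sum_nonneg hnn
    linarith
  · intro h i hi
    have h2 := (sum_eq_zero_iff_of_nonneg hnn).1 (le_antisymm (by linarith) (sum_nonneg hnn)) i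
      (by simp; omega)
    rcases mul_eq_zero.1 h2 with h3 | h3
    · have := hg i hi
      linarith
    · exact h3

lemma sum_split_layers (a b c : ℕ) (f : ℕ → ℚ) :
    ∑ t ∈ range (a + b + c), f t = ∑ t ∈ range a, f t + ∑ t ∈ range b, f (a + t) +
      ∑ t ∈ range c, f (a + b + t) := by
  rw [sum_range_add, sum_range_add]

lemma sum_Icc_eq_sum_range (a b : ℕ) (f : ℕ → ℚ) :
    ∑ t ∈ Icc a (a + b), f t = ∑ i ∈ range (b + 1), f (a + i) := by
  rw [← Finset.Ico_succ_right_eq_Icc, Finset.sum_Ico_eq_sum_range]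
  simp [Nat.add_assoc]

/-! ### The case `n = 3m + 1` -/

lemma core_one {M n : ℕ} (hn : n = 3 * (M + 2) + 1) {F : Fin 3 → Finset (Finset (Fin n))}
    (hF : CrossFree F)
    {a b c : ℚ} (hc : 0 < c) (hcb : c < b) (hba : b < a) :
    a * totalDensity F (M + 2) + b * (totalDensity F (M + 1) + totalDensity F (2 * M + 6)) +
        c * totalDensity F (2 * M + 7) ≤
      (a + 2 * b) * (3 - totalDensity F (M + 3)) + a * (3 - totalDensity F (2 * M + 5)) +
        2 * b * (3 - totalDensity F (2 * M + 4)) + (b + 2 * c) * (3 - totalDensity F (M + 4)) ∧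
    ((a + 2 * b) * (3 - totalDensity F (M + 3)) + a * (3 - totalDensity F (2 * M + 5)) +
        2 * b * (3 - totalDensity F (2 * M + 4)) + (b + 2 * c) * (3 - totalDensity F (M + 4)) ≤
      a * totalDensity F (M + 2) + b * (totalDensity F (M + 1) + totalDensity F (2 * M + 6)) +
        c * totalDensity F (2 * M + 7) →
      (∀ i S, M + 4 ≤ S.card → S.card ≤ 2 * M + 4 → S ∈ F i) →
      ∀ (ρ : Equiv.Perm (Fin 3)), ∀ d ∈ colorings n ![M, 1, 1, M + 3, M + 2],
        (colorUnion d {3} ∉ F (ρ 1) →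
          colorUnion d {0, 1, 2} ∈ F (ρ 0) ∧ colorUnion d {1, 3, 4} ∈ F (ρ 0)) ∧
        (colorUnion d {3} ∈ F (ρ 1) → colorUnion d {1, 4} ∈ F (ρ 2) →
          colorUnion d {0, 1, 2, 3} ∉ F (ρ 2) → colorUnion d {0, 1, 2} ∈ F (ρ 0))) := by
  have hk : ∑ i, ![M, 1, 1, M + 3, M + 2] i = n := by
    simp [Fin.sum_univ_five]; omega
  have key := affine_density ![M, 1, 1, M + 3, M + 2] hk F (2 * a + 5 * b + 2 * c) (terms₁ a b c)
    fun ρ d => (local_one hc hcb hba (hF.crossVal ρ d)).1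
  have e₁ : ∑ l ∈ ({0, 1, 2} : Finset (Fin 5)), ![M, 1, 1, M + 3, M + 2] l = M + 2 := by
    simp
  have e₂ : ∑ l ∈ ({0, 2} : Finset (Fin 5)), ![M, 1, 1, M + 3, M + 2] l = M + 1 := by
    simp
  have e₃ : ∑ l ∈ ({1, 3, 4} : Finset (Fin 5)), ![M, 1, 1, M + 3, M + 2] l = 2 * M + 6 := by
    simp; omega
  have e₄ : ∑ l ∈ ({1, 2, 3, 4} : Finset (Fin 5)), ![M, 1, 1, M + 3, M + 2] l = 2 * M + 7 := by
    simp; omega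
  have e₅ : ∑ l ∈ ({3} : Finset (Fin 5)), ![M, 1, 1, M + 3, M + 2] l = M + 3 := by
    simp
  have e₆ : ∑ l ∈ ({1, 4} : Finset (Fin 5)), ![M, 1, 1, M + 3, M + 2] l = M + 3 := by
    simp; omega
  have e₇ : ∑ l ∈ ({0, 1, 2, 3} : Finset (Fin 5)), ![M, 1, 1, M + 3, M + 2] l = 2 * M + 5 := by
    simp; omega
  have e₈ : ∑ l ∈ ({0, 2, 3} : Finset (Fin 5)), ![M, 1, 1, M + 3, M + 2] l = 2 * M + 4 := by
    simp; omega
  have e₉ : ∑ l ∈ ({0, 1, 2, 4} : Finset (Fin 5)), ![M, 1, 1, M + 3, M + 2] l = 2 * M + 4 := by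
    simp; omega
  have f₁ : ∑ l ∈ ({1, 3} : Finset (Fin 5)), ![M, 1, 1, M + 3, M + 2] l = M + 4 := by
    simp; omega
  have f₂ : ∑ l ∈ ({2, 3} : Finset (Fin 5)), ![M, 1, 1, M + 3, M + 2] l = M + 4 := by
    simp; omega
  have f₃ : ∑ l ∈ ({1, 2, 4} : Finset (Fin 5)), ![M, 1, 1, M + 3, M + 2] l = M + 4 := by
    simp; omega
  obtain ⟨key₁, key₂⟩ := key
  have hsum : 3 * (2 * a + 5 * b + 2 * c) + ((terms₁ a b c).map fun t =>
      t.1 * totalDensity F (∑ l ∈ t.2.2, ![M, 1, 1, M + 3, M + 2] l)).sum =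
      (a + 2 * b) * (3 - totalDensity F (M + 3)) + a * (3 - totalDensity F (2 * M + 5)) +
        2 * b * (3 - totalDensity F (2 * M + 4)) + (b + 2 * c) * (3 - totalDensity F (M + 4)) -
      (a * totalDensity F (M + 2) + b * (totalDensity F (M + 1) + totalDensity F (2 * M + 6)) +
        c * totalDensity F (2 * M + 7)) := by
    simp only [terms₁, List.map_cons, List.map_nil, List.sum_cons, List.sum_nil, e₁, e₂, e₃, e₄, e₅,
      e₆, e₇, e₈, e₉, f₁, f₂, f₃]
    ring
  rw [hsum] at key₁ key₂
  refine ⟨by linarith, fun hle hfull ρ d hd => ?_⟩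
  have h0 := key₂ (by linarith) ρ d hd
  have hcard := card_colorUnion hd
  have full : ∀ i s, M + 4 ≤ ∑ l ∈ s, ![M, 1, 1, M + 3, M + 2] l →
      ∑ l ∈ s, ![M, 1, 1, M + 3, M + 2] l ≤ 2 * M + 4 → ind (F (ρ i)) (colorUnion d s) = 1 :=
    fun i s h1 h2 => ind_eq_one.2 (hfull _ _ (by rw [hcard]; exact h1) (by rw [hcard]; exact h2))
  have := (local_one hc hcb hba (hF.crossVal ρ d)).2 (full _ _ (by rw [e₈]; omega) (by rw [e₈]))
    (full _ _ (by rw [e₉]; omega) (by rw [e₉])) (full _ _ (by rw [f₁]) (by rw [f₁]; omega))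
    (full _ _ (by rw [f₂]) (by rw [f₂]; omega)) (full _ _ (by rw [f₃]) (by rw [f₃]; omega)) h0
  simpa only [ind_eq_one, ind_eq_zero] using this

/-- The equation is what makes the weight a + 2b of layer m+1 a binomial coefficient. -/
lemma choose_ineq_one {M n : ℕ} (hn : n = 3 * (M + 2) + 1) :
    0 < (n.choose M : ℚ) ∧
    (n.choose M : ℚ) < n.choose (M + 1) ∧
    (n.choose (M + 1) : ℚ) < n.choose (M + 2) ∧
    (n.choose (M + 2) : ℚ) + 2 * n.choose (M + 1) =
      n.choose (M + 3) ∧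
    4 * (n.choose M : ℚ) < n.choose (M + 2) ∧
    2 * (n.choose M : ℚ) < n.choose (M + 1) ∧
    2 * (n.choose (M + 1) : ℚ) < n.choose (M + 2) := by
  have h₀ : 0 < (n.choose M : ℚ) := by
    exact_mod_cast Nat.choose_pos (by omega)
  have h₁ := succ_mul_choose_rat n M (by omega)
  have h₂ := succ_mul_choose_rat n (M + 1) (by omega)
  have h₃ := succ_mul_choose_rat n (M + 2) (by omega)
  have h₁' : 0 < (n.choose (M + 1) : ℚ) := by
    exact_mod_cast Nat.choose_pos (by omega)
  have h₂' : 0 < (n.choose (M + 2) : ℚ) := by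
    exact_mod_cast Nat.choose_pos (by omega)
  have hM : (0 : ℚ) ≤ M := by positivity
  have hn' : (n : ℚ) = 3 * (M + 2) + 1 := by exact_mod_cast hn
  rw [hn'] at h₁ h₂ h₃
  push_cast at h₁ h₂ h₃
  generalize (n.choose M : ℚ) = w₀ at *
  generalize (n.choose (M + 1) : ℚ) = w₁ at *
  generalize (n.choose (M + 2) : ℚ) = w₂ at *
  generalize (n.choose (M + 3) : ℚ) = w₃ at *
  generalize (M : ℚ) = x at *
  have k₁ : 2 * w₀ < w₁ := by
    by_contra! h
    nlinarith
  have k₂ : 2 * w₁ < w₂ := by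
    by_contra! h
    nlinarith
  have k₃ : w₂ + 2 * w₁ = w₃ := by
    have : (x + 3) * (w₂ + 2 * w₁) = (x + 3) * w₃ := by nlinarith
    exact mul_left_cancel₀ (by positivity) this
  exact ⟨h₀, by linarith, by linarith, k₃, by linarith, k₁, k₂⟩

lemma bound_one {M n : ℕ} (hn : n = 3 * (M + 2) + 1) {F : Fin 3 → Finset (Finset (Fin n))}
    (hF : CrossFree F) :
    (∑ j ∈ range (M + 3), (n.choose j : ℚ) * totalDensity F j +
      ∑ i ∈ range (M + 2),
        (n.choose (2 * M + 6 + i) : ℚ) * totalDensity F (2 * M + 6 + i) ≤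
      ∑ i ∈ range (M + 3),
        (n.choose (M + 3 + i) : ℚ) * (3 - totalDensity F (M + 3 + i))) ∧
    (∑ i ∈ range (M + 3),
        (n.choose (M + 3 + i) : ℚ) * (3 - totalDensity F (M + 3 + i)) ≤
      ∑ j ∈ range (M + 3), (n.choose j : ℚ) * totalDensity F j +
      ∑ i ∈ range (M + 2),
        (n.choose (2 * M + 6 + i) : ℚ) * totalDensity F (2 * M + 6 + i) →
      (∀ i S, M + 4 ≤ S.card → S.card ≤ 2 * M + 4 → S ∈ F i) ∧
      ∀ (ρ : Equiv.Perm (Fin 3)), ∀ d ∈ colorings n ![M, 1, 1, M + 3, M + 2],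
        (colorUnion d {3} ∉ F (ρ 1) →
          colorUnion d {0, 1, 2} ∈ F (ρ 0) ∧ colorUnion d {1, 3, 4} ∈ F (ρ 0)) ∧
        (colorUnion d {3} ∈ F (ρ 1) → colorUnion d {1, 4} ∈ F (ρ 2) →
          colorUnion d {0, 1, 2, 3} ∉ F (ρ 2) → colorUnion d {0, 1, 2} ∈ F (ρ 0))) := by
  obtain ⟨hw₀, hw₁, hw₂, hw₃, hw₄, hw₅, hw₆⟩ := choose_ineq_one hn
  obtain ⟨core, core_eq⟩ := core_one hn hF hw₀ hw₁ hw₂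
  set P := totalDensity F with hP
  have hP3 : ∀ t, 0 ≤ 3 - P t := fun t => sub_nonneg.2 (totalDensity_le F t)
  have hsym : ∀ t s, t + s = n → (n.choose t : ℚ) = n.choose s := by
    intro t s h
    rw [Nat.choose_symm_of_eq_add h.symm]
  have low : ∑ j ∈ range (M + 3), (n.choose j : ℚ) * P j =
      ∑ i ∈ range (M + 1), (n.choose (M - i) : ℚ) * P (M - i) +
        n.choose (M + 1) * P (M + 1) + n.choose (M + 2) * P (M + 2) := by
    rw [sum_range_succ, sum_range_succ, ← sum_range_reflect]
    simp
  have high : ∑ i ∈ range (M + 2), (n.choose (2 * M + 6 + i) : ℚ) * P (2 * M + 6 + i) =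
      ∑ i ∈ range M, (n.choose (M - (i + 1)) : ℚ) * P (2 * M + 8 + i) +
        n.choose M * P (2 * M + 7) + n.choose (M + 1) * P (2 * M + 6) := by
    rw [sum_range_succ', sum_range_succ', hsym (2 * M + 6 + 0) (M + 1) (by omega),
      hsym (2 * M + 6 + (0 + 1)) M (by omega)]
    congr 2
    refine sum_congr rfl fun i hi => ?_
    simp at hi
    rw [hsym _ (M - (i + 1)) (by omega)]
    congr 2
    omega
  have mid : ∑ i ∈ range (M + 3), (n.choose (M + 3 + i) : ℚ) * (3 - P (M + 3 + i)) =
      ∑ i ∈ range (M + 1), (n.choose (M + 4 + i) : ℚ) * (3 - P (M + 4 + i)) +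
        n.choose (M + 3) * (3 - P (M + 3)) + n.choose (M + 2) * (3 - P (2 * M + 5)) := by
    rw [sum_range_succ', sum_range_succ]
    rw [show M + 3 + (M + 1 + 1) = 2 * M + 5 by omega, hsym (2 * M + 5) (M + 2) (by omega)]
    simp only [show ∀ i, M + 3 + (i + 1) = M + 4 + i by intro i; omega]
    simp only [add_zero]
    ring
  -- Disjoint sets of sizes M - i and M+4+i unite to size 2M+4; the last two sizes are inner.
  have tail₁ : ∑ i ∈ range (M + 1), (n.choose (M - i) : ℚ) * P (M - i) ≤
      n.choose M * ∑ i ∈ range (M + 1), (3 - P (M + 4 + i)) +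
        2 * n.choose M * (3 - P (2 * M + 4)) := by
    have h1 : ∀ i ∈ range (M + 1), (n.choose (M - i) : ℚ) * P (M - i) ≤
        n.choose M * (3 - P (M + 4 + i)) + n.choose (M - i) * (3 - P (2 * M + 4)) := by
      intro i hi
      simp at hi
      have h2 := hF.totalDensity_add_le (s := M - i) (t := M + 4 + i) (by omega)
      rw [show M - i + (M + 4 + i) = 2 * M + 4 by omega] at h2
      have h3 : (n.choose (M - i) : ℚ) ≤ n.choose M := by
        exact_mod_cast choose_le_choose_of_add_le (by omega) (by omega)
      have h4 := mul_le_mul_of_nonneg_right h3 (hP3 (M + 4 + i))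
      have h5 : (0 : ℚ) ≤ n.choose (M - i) := by positivity
      have h6 := mul_le_mul_of_nonneg_left h2 h5
      simp only [← hP] at h6
      linarith
    have h2 := sum_le_sum h1
    rw [sum_add_distrib, ← mul_sum, ← sum_mul] at h2
    have h3 := sum_choose_sub_le (n := n) (q := M) (by omega) (le_refl (M + 1))
    have h4 := mul_le_mul_of_nonneg_right h3 (hP3 (2 * M + 4))
    linarith
  -- An outer set of size 2M+8+i splits into inner sets of sizes M+4 and M+4+i.
  have tail₂ : ∑ i ∈ range M, (n.choose (M - (i + 1)) : ℚ) * P (2 * M + 8 + i) ≤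
      n.choose M * ∑ i ∈ range (M + 1), (3 - P (M + 4 + i)) +
        2 * n.choose M * (3 - P (M + 4)) := by
    have h1 : ∀ i ∈ range M, (n.choose (M - (i + 1)) : ℚ) * P (2 * M + 8 + i) ≤
        n.choose M * (3 - P (M + 4 + i)) + n.choose (M - (i + 1)) * (3 - P (M + 4)) := by
      intro i hi
      simp at hi
      have h2 := hF.totalDensity_add_le (s := M + 4) (t := M + 4 + i) (by omega)
      rw [show M + 4 + (M + 4 + i) = 2 * M + 8 + i by omega] at h2
      have h3 : (n.choose (M - (i + 1)) : ℚ) ≤ n.choose M := by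
        exact_mod_cast choose_le_choose_of_add_le (by omega) (by omega)
      have h4 := mul_le_mul_of_nonneg_right h3 (hP3 (M + 4 + i))
      have h5 : (0 : ℚ) ≤ n.choose (M - (i + 1)) := by positivity
      have h6 := mul_le_mul_of_nonneg_left h2 h5
      simp only [← hP] at h6
      linarith
    have h2 := sum_le_sum h1
    rw [sum_add_distrib, ← mul_sum, ← sum_mul] at h2
    have h3 := sum_choose_sub_le (n := n) (q := M) (by omega) (le_refl (M + 1))
    rw [sum_range_succ'] at h3
    have h3' : ∑ i ∈ range M, (n.choose (M - (i + 1)) : ℚ) ≤ 2 * n.choose M := by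
      have : (0 : ℚ) ≤ n.choose (M - 0) := by positivity
      linarith
    have h4 := mul_le_mul_of_nonneg_right h3' (hP3 (M + 4))
    have h5 : (n.choose M : ℚ) * ∑ i ∈ range M, (3 - P (M + 4 + i)) ≤
        n.choose M * ∑ i ∈ range (M + 1), (3 - P (M + 4 + i)) := by
      rw [sum_range_succ]
      have := mul_nonneg hw₀.le (hP3 (M + 4 + M))
      linarith
    linarith
  -- The two tails charge C(n,M) each to every layer M+4+i, hence the subtraction in g. On layer
  -- 2M+4 fall 2b from the core and 2C(n,M) from the first tail; on layer M+4 fall b + 2c and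
  -- 2C(n,M) from the second.
  have ends := sum_with_endpoints (k := M)
    (g := fun i => (n.choose (M + 4 + i) : ℚ) - 2 * n.choose M) (E := fun i => 3 - P (M + 4 + i))
    (α := 2 * n.choose (M + 1) + 2 * n.choose M) (β := n.choose (M + 1) + 4 * n.choose M)
    (fun i => hP3 _) (by
      intro i hi
      -- For M = 0, that is n = 7, both endpoints are layer 4, and the claim is 27 < 33.
      rcases Nat.eq_zero_or_pos M with rfl | hM
      · obtain rfl : i = 0 := by omega
        subst hn
        norm_num [Nat.choose]
      · have hge : ∀ t, M + 3 ≤ t → t ≤ 2 * M + 4 → (n.choose (M + 3) : ℚ) ≤ n.choose t := by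
          intro t h1 h2
          exact_mod_cast choose_le_choose_of_add_le h1 (by omega)
        have := hge (M + 4 + i) (by omega) (by omega)
        split_ifs with h1 h2 h2 <;> first | omega | linarith)
  simp only [sub_mul] at ends
  rw [sum_sub_distrib] at ends
  simp only [mul_assoc, ← mul_sum] at ends
  rw [show M + 4 + M = 2 * M + 4 by omega, add_zero] at ends
  obtain ⟨ends₁, ends₂⟩ := ends
  rw [low, high, mid, ← hw₃]
  constructor
  · linarith
  · intro hle
    have hfull : ∀ i S, M + 4 ≤ S.card → S.card ≤ 2 * M + 4 → S ∈ F i := by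
      intro i S h1 h2
      have h3 := ends₂ (by linarith) (S.card - (M + 4)) (by omega)
      rw [show M + 4 + (S.card - (M + 4)) = S.card by omega] at h3
      exact mem_of_totalDensity (by linarith) i
    exact ⟨hfull, core_eq (by linarith) hfull⟩

/-! ### Equality for n = 3m + 1. -/

lemma colorUnion_eq_compl {n r : ℕ} (c : Fin n → Fin r) {s t : Finset (Fin r)} (h : s = tᶜ) :
    colorUnion c s = (colorUnion c t)ᶜ := by
  subst h; ext x; simp [colorUnion]

lemma totalDensity_eq_three {n : ℕ} {F : Fin 3 → Finset (Finset (Fin n))} {t : ℕ} (ht : t ≤ n)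
    (h : ∀ i S, S.card = t → S ∈ F i) : totalDensity F t = 3 := by
  have h1 : ∀ i, density (F i) t = 1 := by
    intro i
    have h2 : ((F i).filter fun S => S.card = t) = univ.filter fun S => S.card = t := by
      ext S
      simp only [mem_filter, mem_univ, true_and, and_iff_right_iff_imp]
      exact h i S
    have h3 : (n.choose t : ℚ) ≠ 0 := by exact_mod_cast (Nat.choose_pos ht).ne'
    rw [density, h2, card_layer, div_self h3]
  simp [totalDensity, h1]

/-- If the layers in the weighted sum over outer layers contribute nothing, no family contains
a set of such a size. -/
lemma notMem_of_sum_totalDensity {n : ℕ} {F : Fin 3 → Finset (Finset (Fin n))} {a k : ℕ}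
    (h : ∑ i ∈ range k, (n.choose (a + i) : ℚ) * totalDensity F (a + i) ≤ 0)
    {S : Finset (Fin n)} (h₁ : a ≤ S.card) (h₂ : S.card < a + k) (j : Fin 3) : S ∉ F j := by
  have hnn : ∀ i ∈ range k, 0 ≤ (n.choose (a + i) : ℚ) * totalDensity F (a + i) :=
    fun i _ => mul_nonneg (by positivity) (totalDensity_nonneg F _)
  have h0 := (sum_eq_zero_iff_of_nonneg hnn).1 (le_antisymm h (sum_nonneg hnn)) (S.card - a)
    (by simp; omega)
  rw [show a + (S.card - a) = S.card by omega] at h0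
  rcases mul_eq_zero.1 h0 with h3 | h3
  · have hS : S.card ≤ n := by simpa using card_le_univ S
    have := Nat.choose_pos hS
    have h4 : n.choose S.card = 0 := by exact_mod_cast h3
    omega
  · exact notMem_of_totalDensity h3 j

lemma CrossFree.comp {n : ℕ} {F : Fin 3 → Finset (Finset (Fin n))} (h : CrossFree F)
    {i j k : Fin 3} (ρ : Equiv.Perm (Fin 3)) {A B : Finset (Fin n)} (hA : A ∈ F (ρ i))
    (hB : B ∈ F (ρ j)) (hd : Disjoint A B) (hC : A ∪ B ∈ F (ρ k))
    (hne : i ≠ j ∧ i ≠ k ∧ j ≠ k) : False :=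
  h _ _ _ (ρ.injective.ne hne.1) (ρ.injective.ne hne.2.1) (ρ.injective.ne hne.2.2) A hA B hB hd hC

lemma middle_one {M n : ℕ} (hn : n = 3 * (M + 2) + 1) {F : Fin 3 → Finset (Finset (Fin n))}
    (hF : CrossFree F) (hfull : ∀ i S, M + 4 ≤ S.card → S.card ≤ 2 * M + 4 → S ∈ F i)
    (hloc : ∀ (ρ : Equiv.Perm (Fin 3)), ∀ d ∈ colorings n ![M, 1, 1, M + 3, M + 2],
        (colorUnion d {3} ∉ F (ρ 1) →
          colorUnion d {0, 1, 2} ∈ F (ρ 0) ∧ colorUnion d {1, 3, 4} ∈ F (ρ 0)) ∧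
        (colorUnion d {3} ∈ F (ρ 1) → colorUnion d {1, 4} ∈ F (ρ 2) →
          colorUnion d {0, 1, 2, 3} ∉ F (ρ 2) → colorUnion d {0, 1, 2} ∈ F (ρ 0)))
    (i : Fin 3) (S : Finset (Fin n)) (h₁ : M + 3 ≤ S.card) (h₂ : S.card ≤ 2 * M + 5) :
    S ∈ F i := by
  have hk : ∑ i, ![M, 1, 1, M + 3, M + 2] i = n := by
    simp [Fin.sum_univ_five]; omega
  have small : ∀ i B, B.card = M + 3 → B ∈ F i := by
    intro i B hB
    by_contra hBi
    have hBc : (Bᶜ).card = 2 * M + 4 := by rw [card_compl, hB, Fintype.card_fin]; omega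
    obtain ⟨A, hAB, hA⟩ := exists_subset_card_eq (s := Bᶜ) (n := M + 2) (by omega)
    have hdAB : Disjoint A B := by
      rw [← le_compl_iff_disjoint_right]; exact hAB
    obtain ⟨z, hz⟩ : (Bᶜ \ A).Nonempty := by
      rw [← card_pos, card_sdiff_of_subset hAB]; omega
    simp only [mem_sdiff, mem_compl] at hz
    have hE : (insert z B).card = M + 4 := by rw [card_insert_of_notMem hz.1, hB]
    have hdE : Disjoint A (insert z B) := by
      rw [disjoint_insert_right]; exact ⟨hz.2, hdAB⟩
    have key : ∀ ρ : Equiv.Perm (Fin 3), ρ 1 = i → A ∈ F (ρ 0) ∧ A ∪ insert z B ∈ F (ρ 0) := by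
      intro ρ hρ
      obtain ⟨c, hc, hcA, hcB⟩ := exists_coloring ![M, 1, 1, M + 3, M + 2] hk
        (s := {0, 1, 2}) (t := {3}) (by decide) hdAB (by simp [hA]) (by simp [hB])
      have hC : ((A ∪ insert z B)ᶜ).card = M + 1 := by
        rw [card_compl, card_union_of_disjoint hdE, hA, hE, Fintype.card_fin]; omega
      -- The union of A and B + z, of size 2m+2, is realised as {1, 3, 4}, through its complement
      -- {0, 2}.
      obtain ⟨d, hd, hdA, hdB⟩ := exists_coloring ![M, 1, 1, M + 3, M + 2] hk
        (s := {0, 2}) (t := {3}) (by decide) (S := (A ∪ insert z B)ᶜ) (T := B)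
        (by
          rw [Finset.disjoint_left]
          intro x hx hxB
          simp [hxB] at hx)
        (hC.trans (by simp)) (by simp [hB])
      constructor
      · have := ((hloc ρ c hc).1 (by rw [hcB, hρ]; exact hBi)).1
        rwa [hcA] at this
      · have := ((hloc ρ d hd).1 (by rw [hdB, hρ]; exact hBi)).2
        rw [colorUnion_eq_compl d (t := {0, 2}) (by decide), hdA, compl_compl] at this
        exact this
    -- Two role assignments, both giving role 1 to i, put A in one of the other families and its
    -- union with B + z in the remaining one. Since B + z lies in a full layer of the i-th family,
    -- this is a forbidden triple.
    obtain ⟨-, hC0⟩ := key (Equiv.swap 1 i) (Equiv.swap_apply_left _ _)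
    obtain ⟨hA2, -⟩ := key (Equiv.swap 1 i * Equiv.swap 0 2) (by
      rw [Equiv.Perm.mul_apply, show Equiv.swap (0 : Fin 3) 2 1 = 1 by decide,
        Equiv.swap_apply_left])
    rw [Equiv.Perm.mul_apply, Equiv.swap_apply_left] at hA2
    exact hF.comp (Equiv.swap 1 i) hA2 (hfull (Equiv.swap 1 i 1) _ hE.ge (by omega)) hdE hC0
      (by decide)
  have large : ∀ i T, T.card = 2 * M + 5 → T ∈ F i := by
    intro i T hT
    by_contra hTi
    -- Both other families contain all m-subsets of a missing (2m+1)-set T. Two disjoint ones, taken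
    -- from different families, unite to a 2m-set, which the i-th family contains.
    have key : ∀ ρ : Equiv.Perm (Fin 3), ρ 2 = i → ∀ A ⊆ T, A.card = M + 2 → A ∈ F (ρ 0) := by
      intro ρ hρ A hAT hA
      have hTA : (T \ A).card = M + 3 := by rw [card_sdiff_of_subset hAT]; omega
      obtain ⟨c, hc, hcA, hcB⟩ := exists_coloring ![M, 1, 1, M + 3, M + 2] hk
        (s := {0, 1, 2}) (t := {3}) (by decide) (disjoint_sdiff (s := A) (t := T)) (by simp [hA])
        (by simp [hTA])
      have hcard := card_colorUnion hc
      have := (hloc ρ c hc).2 (small _ _ (by rw [hcard]; simp))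
        (small _ _ (by rw [hcard]; simp; omega)) (by
          rw [show ({0, 1, 2, 3} : Finset (Fin 5)) = {0, 1, 2} ∪ {3} by decide, colorUnion_union,
            hcA, hcB, union_sdiff_of_subset hAT, hρ]
          exact hTi)
      rwa [hcA] at this
    obtain ⟨A, hAT, hA⟩ := exists_subset_card_eq (s := T) (n := M + 2) (by omega)
    obtain ⟨A', hAT', hA'⟩ := exists_subset_card_eq (s := T \ A) (n := M + 2)
      (by rw [card_sdiff_of_subset hAT]; omega)
    have hd : Disjoint A A' := disjoint_of_subset_right hAT' disjoint_sdiff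
    have h0 := key (Equiv.swap 2 i) (Equiv.swap_apply_left _ _) A hAT hA
    have h1 := key (Equiv.swap 2 i * Equiv.swap 0 1) (by
      rw [Equiv.Perm.mul_apply, show Equiv.swap (0 : Fin 3) 1 2 = 2 by decide,
        Equiv.swap_apply_left]) A' (hAT'.trans sdiff_subset) hA'
    rw [Equiv.Perm.mul_apply, Equiv.swap_apply_left] at h1
    exact hF.comp (Equiv.swap 2 i) h0 h1 hd (k := 2)
      (hfull _ _ (by rw [card_union_of_disjoint hd]; omega)
        (by rw [card_union_of_disjoint hd]; omega)) (by decide)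
  by_cases h3 : S.card = M + 3
  · exact small i S h3
  by_cases h4 : S.card = 2 * M + 5
  · exact large i S h4
  exact hfull i S (by omega) (by omega)

lemma mem_layers {n a b : ℕ} {S : Finset (Fin n)} :
    S ∈ layers n a b ↔ a ≤ S.card ∧ S.card ≤ b := by
  simp [layers]

lemma card_layers (n a b : ℕ) : (layers n a b).card = ∑ t ∈ Icc a b, n.choose t := by
  rw [card_eq_sum_card_fiberwise (f := Finset.card) (t := Icc a b)]
  · refine sum_congr rfl fun t ht => ?_
    rw [← card_layer]
    congr 1
    ext S
    rw [mem_Icc] at ht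
    simp only [mem_filter, mem_layers, mem_univ, true_and, and_iff_right_iff_imp]
    rintro rfl
    exact ht
  · intro S hS
    simpa [mem_layers] using hS

/-- The bound minus the total size is the inner loss minus the outer gain, the form treated by
`bound_one` and `bound_two`. -/
lemma sum_choose_sub_sum_card {n a b c : ℕ} (hn : n + 1 = a + (b + 1) + c)
    (F : Fin 3 → Finset (Finset (Fin n))) :
    ((3 * ∑ t ∈ Icc a (a + b), n.choose t : ℕ) : ℚ) -
      (((F 0).card + (F 1).card + (F 2).card : ℕ) : ℚ) =
      ∑ i ∈ range (b + 1), (n.choose (a + i) : ℚ) * (3 - totalDensity F (a + i)) -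
      (∑ j ∈ range a, (n.choose j : ℚ) * totalDensity F j +
        ∑ i ∈ range c,
          (n.choose (a + (b + 1) + i) : ℚ) * totalDensity F (a + (b + 1) + i)) := by
  rw [sum_card_eq_sum_totalDensity, hn, sum_split_layers]
  push_cast
  rw [sum_Icc_eq_sum_range a b (fun t => (n.choose t : ℚ))]
  simp only [mul_sub, sum_sub_distrib]
  rw [mul_sum]
  simp only [mul_comm (3 : ℚ)]
  ring

theorem extremal_one {m : ℕ} (hm : 2 ≤ m) {F : Fin 3 → Finset (Finset (Fin (3 * m + 1)))}
    (hF : CrossFree F) :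
    (F 0).card + (F 1).card + (F 2).card
        ≤ 3 * ∑ t ∈ Icc (m + 1) (2 * m + 1), (3 * m + 1).choose t ∧
    ((F 0).card + (F 1).card + (F 2).card
        = 3 * ∑ t ∈ Icc (m + 1) (2 * m + 1), (3 * m + 1).choose t ↔
      ∀ i, F i = kleitmanFamily (3 * m + 1)) := by
  -- With m = M + 2 the sizes m - 1 and m - 2 involve no truncated subtraction.
  obtain ⟨M, rfl⟩ := Nat.exists_eq_add_of_le' hm
  have hdiff := sum_choose_sub_sum_card (a := M + 3) (b := M + 2) (c := M + 2) (by omega) F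
  rw [show M + 3 + (M + 2) = 2 * (M + 2) + 1 by omega,
    show M + 3 + (M + 2 + 1) = 2 * M + 6 by omega] at hdiff
  obtain ⟨hle, heq⟩ := bound_one rfl hF
  refine ⟨?_, fun h => ?_, fun h => ?_⟩
  · have : (((F 0).card + (F 1).card + (F 2).card : ℕ) : ℚ) ≤
        ((3 * ∑ t ∈ Icc (M + 3) (2 * (M + 2) + 1), (3 * (M + 2) + 1).choose t : ℕ) : ℚ) := by
      linarith
    exact_mod_cast this
  · rw [h, sub_self] at hdiff
    obtain ⟨hfull, hloc⟩ := heq (by linarith)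
    have hmid := middle_one rfl hF hfull hloc
    have h0 : ∑ i ∈ range (M + 3), ((3 * (M + 2) + 1).choose (M + 3 + i) : ℚ) *
        (3 - totalDensity F (M + 3 + i)) = 0 := by
      refine sum_eq_zero fun i hi => ?_
      simp only [mem_range] at hi
      rw [totalDensity_eq_three (by omega) fun j S hS => hmid j S (by omega) (by omega)]
      simp
    have hlow : 0 ≤ ∑ j ∈ range (M + 3), ((3 * (M + 2) + 1).choose j : ℚ) * totalDensity F j :=
      sum_nonneg fun j _ => mul_nonneg (by positivity) (totalDensity_nonneg F _)
    have hhigh : 0 ≤ ∑ i ∈ range (M + 2), ((3 * (M + 2) + 1).choose (2 * M + 6 + i) : ℚ) *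
        totalDensity F (2 * M + 6 + i) :=
      sum_nonneg fun j _ => mul_nonneg (by positivity) (totalDensity_nonneg F _)
    intro i
    ext S
    have hS : S.card ≤ 3 * (M + 2) + 1 := by simpa using card_le_univ S
    rw [kleitmanFamily, mem_layers, show (3 * (M + 2) + 1) / 3 = M + 2 by omega]
    refine ⟨fun hSi => ?_, fun hSi => hmid i S (by omega) (by omega)⟩
    by_contra hcon
    rcases lt_or_ge S.card (M + 3) with h1 | h1
    · refine notMem_of_sum_totalDensity (F := F) (a := 0) (k := M + 3) ?_ (Nat.zero_le _)
        (by omega) i hSi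
      simp only [zero_add]
      linarith
    · refine notMem_of_sum_totalDensity (F := F) (a := 2 * M + 6) (k := M + 2) ?_ (by omega)
        (by omega) i hSi
      linarith
  · simp only [h, kleitmanFamily, card_layers]
    rw [show (3 * (M + 2) + 1) / 3 = M + 2 by omega]
    ring

/-! ### The case `n = 3m + 2` -/

-- The X-side and the Y-side of `terms₂` contribute alike, so averaging `local_two` gives twice this
-- inequality.
set_option maxHeartbeats 1000000 in
lemma core_two {M n : ℕ} (hn : n = 3 * (M + 2) + 2) (hM : 1 ≤ M)
    {F : Fin 3 → Finset (Finset (Fin n))} (hF : CrossFree F) {a b : ℚ} (hb : 0 < b)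
    (hba : 2 * b < a) :
    a * (totalDensity F (M + 2) + totalDensity F (2 * M + 6)) +
        b * (totalDensity F (M + 1) + totalDensity F (2 * M + 7)) ≤
      2 * a * ((3 - totalDensity F (M + 3)) + (3 - totalDensity F (2 * M + 5))) +
        2 * b * (3 - totalDensity F (2 * M + 4)) + 5 * b * (3 - totalDensity F (M + 4)) ∧
    (2 * a * ((3 - totalDensity F (M + 3)) + (3 - totalDensity F (2 * M + 5))) +
        2 * b * (3 - totalDensity F (2 * M + 4)) + 5 * b * (3 - totalDensity F (M + 4)) ≤
      a * (totalDensity F (M + 2) + totalDensity F (2 * M + 6)) +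
        b * (totalDensity F (M + 1) + totalDensity F (2 * M + 7)) →
      (∀ i S, M + 4 ≤ S.card → S.card ≤ 2 * M + 4 → S ∈ F i) →
      ∀ (ρ : Equiv.Perm (Fin 3)), ∀ d ∈ colorings n ![M + 1, 1, M + 1, 1, M + 3, 1],
        colorUnion d {0} ∉ F (ρ 0) ∧ colorUnion d {1, 2, 3, 4, 5} ∉ F (ρ 0) ∧
        (colorUnion d {0, 1} ∈ F (ρ 0) →
          colorUnion d {4} ∈ F (ρ 1) ∧ colorUnion d {2, 3, 5} ∉ F (ρ 2)) ∧
        (colorUnion d {0, 1} ∉ F (ρ 0) → colorUnion d {2, 3} ∉ F (ρ 2) →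
          ind (F (ρ 0)) (colorUnion d {2, 3, 4, 5}) =
            (1 - ind (F (ρ 1)) (colorUnion d {4})) + (1 - ind (F (ρ 2)) (colorUnion d {2, 3, 5})) ∧
          colorUnion d {0, 1, 2, 3, 5} ∈ F (ρ 1))) := by
  have hk : ∑ i, ![M + 1, 1, M + 1, 1, M + 3, 1] i = n := by
    simp [Fin.sum_univ_six]; omega
  obtain ⟨key₁, key₂⟩ := affine_density ![M + 1, 1, M + 1, 1, M + 3, 1] hk F (8 * a + 14 * b) (terms₂ a b)
    fun ρ d => (local_two hb hba (hF.crossVal ρ d)).1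
  have e01 : ∑ l ∈ ({0, 1} : Finset (Fin 6)), ![M + 1, 1, M + 1, 1, M + 3, 1] l = M + 2 := by
    simp
  have e2345 : ∑ l ∈ ({2, 3, 4, 5} : Finset (Fin 6)), ![M + 1, 1, M + 1, 1, M + 3, 1] l = 2 * M + 6 := by
    simp; omega
  have e23 : ∑ l ∈ ({2, 3} : Finset (Fin 6)), ![M + 1, 1, M + 1, 1, M + 3, 1] l = M + 2 := by
    simp
  have e0145 : ∑ l ∈ ({0, 1, 4, 5} : Finset (Fin 6)), ![M + 1, 1, M + 1, 1, M + 3, 1] l = 2 * M + 6 := by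
    simp; omega
  have e0 : ∑ l ∈ ({0} : Finset (Fin 6)), ![M + 1, 1, M + 1, 1, M + 3, 1] l = M + 1 := by
    simp
  have e12345 : ∑ l ∈ ({1, 2, 3, 4, 5} : Finset (Fin 6)), ![M + 1, 1, M + 1, 1, M + 3, 1] l = 2 * M + 7 := by
    simp; omega
  have e2 : ∑ l ∈ ({2} : Finset (Fin 6)), ![M + 1, 1, M + 1, 1, M + 3, 1] l = M + 1 := by
    simp
  have e01345 : ∑ l ∈ ({0, 1, 3, 4, 5} : Finset (Fin 6)), ![M + 1, 1, M + 1, 1, M + 3, 1] l = 2 * M + 7 := by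
    simp; omega
  have e4 : ∑ l ∈ ({4} : Finset (Fin 6)), ![M + 1, 1, M + 1, 1, M + 3, 1] l = M + 3 := by
    simp
  have e235 : ∑ l ∈ ({2, 3, 5} : Finset (Fin 6)), ![M + 1, 1, M + 1, 1, M + 3, 1] l = M + 3 := by
    simp
  have e015 : ∑ l ∈ ({0, 1, 5} : Finset (Fin 6)), ![M + 1, 1, M + 1, 1, M + 3, 1] l = M + 3 := by
    simp
  have e01235 : ∑ l ∈ ({0, 1, 2, 3, 5} : Finset (Fin 6)), ![M + 1, 1, M + 1, 1, M + 3, 1] l = 2 * M + 5 := by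
    simp; omega
  have e014 : ∑ l ∈ ({0, 1, 4} : Finset (Fin 6)), ![M + 1, 1, M + 1, 1, M + 3, 1] l = 2 * M + 5 := by
    simp; omega
  have e234 : ∑ l ∈ ({2, 3, 4} : Finset (Fin 6)), ![M + 1, 1, M + 1, 1, M + 3, 1] l = 2 * M + 5 := by
    simp; omega
  have e04 : ∑ l ∈ ({0, 4} : Finset (Fin 6)), ![M + 1, 1, M + 1, 1, M + 3, 1] l = 2 * M + 4 := by
    simp; omega
  have e0235 : ∑ l ∈ ({0, 2, 3, 5} : Finset (Fin 6)), ![M + 1, 1, M + 1, 1, M + 3, 1] l = 2 * M + 4 := by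
    simp; omega
  have e24 : ∑ l ∈ ({2, 4} : Finset (Fin 6)), ![M + 1, 1, M + 1, 1, M + 3, 1] l = 2 * M + 4 := by
    simp; omega
  have e0125 : ∑ l ∈ ({0, 1, 2, 5} : Finset (Fin 6)), ![M + 1, 1, M + 1, 1, M + 3, 1] l = 2 * M + 4 := by
    simp; omega
  have e14 : ∑ l ∈ ({1, 4} : Finset (Fin 6)), ![M + 1, 1, M + 1, 1, M + 3, 1] l = M + 4 := by
    simp; omega
  have e1235 : ∑ l ∈ ({1, 2, 3, 5} : Finset (Fin 6)), ![M + 1, 1, M + 1, 1, M + 3, 1] l = M + 4 := by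
    simp; omega
  have e34 : ∑ l ∈ ({3, 4} : Finset (Fin 6)), ![M + 1, 1, M + 1, 1, M + 3, 1] l = M + 4 := by
    simp; omega
  have e0135 : ∑ l ∈ ({0, 1, 3, 5} : Finset (Fin 6)), ![M + 1, 1, M + 1, 1, M + 3, 1] l = M + 4 := by
    simp
  have e45 : ∑ l ∈ ({4, 5} : Finset (Fin 6)), ![M + 1, 1, M + 1, 1, M + 3, 1] l = M + 4 := by
    simp
  have hsum : 3 * (8 * a + 14 * b) + ((terms₂ a b).map fun t =>
      t.1 * totalDensity F (∑ l ∈ t.2.2, ![M + 1, 1, M + 1, 1, M + 3, 1] l)).sum =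
      2 * (2 * a * ((3 - totalDensity F (M + 3)) + (3 - totalDensity F (2 * M + 5))) +
        2 * b * (3 - totalDensity F (2 * M + 4)) + 5 * b * (3 - totalDensity F (M + 4)) -
      (a * (totalDensity F (M + 2) + totalDensity F (2 * M + 6)) +
        b * (totalDensity F (M + 1) + totalDensity F (2 * M + 7)))) := by
    simp only [terms₂, List.map_cons, List.map_nil, List.sum_cons, List.sum_nil, e01, e2345, e23, e0145, e0, e12345, e2, e01345, e4, e235, e015, e01235,
      e014, e234, e04, e0235, e24, e0125, e14, e1235, e34, e0135, e45]
    ring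
  rw [hsum] at key₁ key₂
  refine ⟨by linarith, fun hle hfull ρ d hd => ?_⟩
  have h0 := key₂ (by linarith) ρ d hd
  have hcard := card_colorUnion hd
  have full : ∀ i s, M + 4 ≤ ∑ l ∈ s, ![M + 1, 1, M + 1, 1, M + 3, 1] l →
      ∑ l ∈ s, ![M + 1, 1, M + 1, 1, M + 3, 1] l ≤ 2 * M + 4 → ind (F (ρ i)) (colorUnion d s) = 1 :=
    fun i s h1 h2 => ind_eq_one.2 (hfull _ _ (by rw [hcard]; exact h1) (by rw [hcard]; exact h2))
  obtain ⟨g₁, g₂, g₃, g₄⟩ := (local_two hb hba (hF.crossVal ρ d)).2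
    (full _ _ (by rw [e04]; try omega) (by rw [e04]; try omega))
    (full _ _ (by rw [e0235]; try omega) (by rw [e0235]; try omega))
    (full _ _ (by rw [e24]; try omega) (by rw [e24]; try omega))
    (full _ _ (by rw [e0125]; try omega) (by rw [e0125]; try omega))
    (full _ _ (by rw [e14]; try omega) (by rw [e14]; try omega))
    (full _ _ (by rw [e1235]; try omega) (by rw [e1235]; try omega))
    (full _ _ (by rw [e34]; try omega) (by rw [e34]; try omega))
    (full _ _ (by rw [e0135]; try omega) (by rw [e0135]; try omega))
    (full _ _ (by rw [e45]; try omega) (by rw [e45]; try omega)) h0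
  simp only [ind_eq_one, ind_eq_zero] at g₁ g₂ g₃ g₄
  exact ⟨g₁, g₂, g₃, g₄⟩

lemma choose_ineq_two {M n : ℕ} (hn : n = 3 * (M + 2) + 2) :
    0 < (n.choose M : ℚ) ∧ 2 * (n.choose M : ℚ) < n.choose (M + 1) ∧
    2 * (n.choose (M + 1) : ℚ) < n.choose (M + 2) ∧
    2 * (n.choose (M + 2) : ℚ) = n.choose (M + 3) ∧
    7 * (n.choose (M + 1) : ℚ) < n.choose (M + 4) := by
  have h₀ : 0 < (n.choose M : ℚ) := by
    exact_mod_cast Nat.choose_pos (by omega)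
  have h₁ := succ_mul_choose_rat n M (by omega)
  have h₂ := succ_mul_choose_rat n (M + 1) (by omega)
  have h₃ := succ_mul_choose_rat n (M + 2) (by omega)
  have h₄ := succ_mul_choose_rat n (M + 3) (by omega)
  have h₁' : 0 < (n.choose (M + 1) : ℚ) := by
    exact_mod_cast Nat.choose_pos (by omega)
  have h₂' : 0 < (n.choose (M + 2) : ℚ) := by
    exact_mod_cast Nat.choose_pos (by omega)
  have hM : (0 : ℚ) ≤ M := by positivity
  have hn' : (n : ℚ) = 3 * (M + 2) + 2 := by exact_mod_cast hn
  rw [hn'] at h₁ h₂ h₃ h₄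
  push_cast at h₁ h₂ h₃ h₄
  simp only [Nat.add_assoc, Nat.reduceAdd] at h₁ h₂ h₃ h₄
  generalize (n.choose M : ℚ) = w₀ at *
  generalize (n.choose (M + 1) : ℚ) = w₁ at *
  generalize (n.choose (M + 2) : ℚ) = w₂ at *
  generalize (n.choose (M + 3) : ℚ) = w₃ at *
  generalize (n.choose (M + 4) : ℚ) = w₄ at *
  generalize (M : ℚ) = x at *
  have k₁ : 2 * w₀ < w₁ := by
    by_contra! h
    nlinarith
  have k₂ : 2 * w₁ < w₂ := by
    by_contra! h
    nlinarith
  have k₃ : 2 * w₂ = w₃ := by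
    have : (x + 3) * (2 * w₂) = (x + 3) * w₃ := by nlinarith
    exact mul_left_cancel₀ (by positivity) this
  have k₄ : (2 * x + 7) * (x + 4) * w₄ = 2 * (2 * x + 5) * ((2 * x + 7) * w₂) := by
    rw [← k₃] at h₄
    linear_combination (2 * x + 7) * h₄
  have k₅ : (2 * x + 7) * w₁ = (x + 2) * w₂ := by linear_combination -h₂
  refine ⟨h₀, k₁, k₂, k₃, ?_⟩
  have k₆ : (2 * x + 7) * (x + 4) * (7 * w₁) < (2 * x + 7) * (x + 4) * w₄ := by
    rw [k₄]
    have : (2 * x + 7) * (x + 4) * (7 * w₁) = 7 * (x + 4) * ((x + 2) * w₂) := by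
      rw [← k₅]; ring
    rw [this]
    have h6 : 7 * (x + 4) * (x + 2) < 2 * (2 * x + 5) * (2 * x + 7) := by nlinarith
    have := mul_lt_mul_of_pos_right h6 h₂'
    linarith
  exact lt_of_mul_lt_mul_left k₆ (by positivity)

lemma bound_two {M n : ℕ} (hn : n = 3 * (M + 2) + 2) (hM : 1 ≤ M)
    {F : Fin 3 → Finset (Finset (Fin n))} (hF : CrossFree F) :
    (∑ j ∈ range (M + 3), (n.choose j : ℚ) * totalDensity F j +
      ∑ i ∈ range (M + 3), (n.choose (2 * M + 6 + i) : ℚ) * totalDensity F (2 * M + 6 + i) ≤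
      ∑ i ∈ range (M + 3), (n.choose (M + 3 + i) : ℚ) * (3 - totalDensity F (M + 3 + i))) ∧
    (∑ i ∈ range (M + 3), (n.choose (M + 3 + i) : ℚ) * (3 - totalDensity F (M + 3 + i)) ≤
      ∑ j ∈ range (M + 3), (n.choose j : ℚ) * totalDensity F j +
      ∑ i ∈ range (M + 3), (n.choose (2 * M + 6 + i) : ℚ) * totalDensity F (2 * M + 6 + i) →
      (∀ i S, M + 4 ≤ S.card → S.card ≤ 2 * M + 4 → S ∈ F i) ∧
      ∀ (ρ : Equiv.Perm (Fin 3)), ∀ d ∈ colorings n ![M + 1, 1, M + 1, 1, M + 3, 1],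
        colorUnion d {0} ∉ F (ρ 0) ∧ colorUnion d {1, 2, 3, 4, 5} ∉ F (ρ 0) ∧
        (colorUnion d {0, 1} ∈ F (ρ 0) →
          colorUnion d {4} ∈ F (ρ 1) ∧ colorUnion d {2, 3, 5} ∉ F (ρ 2)) ∧
        (colorUnion d {0, 1} ∉ F (ρ 0) → colorUnion d {2, 3} ∉ F (ρ 2) →
          ind (F (ρ 0)) (colorUnion d {2, 3, 4, 5}) =
            (1 - ind (F (ρ 1)) (colorUnion d {4})) + (1 - ind (F (ρ 2)) (colorUnion d {2, 3, 5})) ∧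
          colorUnion d {0, 1, 2, 3, 5} ∈ F (ρ 1))) := by
  obtain ⟨hw₀, hw₁, hw₂, hw₃, hw₄⟩ := choose_ineq_two hn
  obtain ⟨core, core_eq⟩ := core_two hn hM hF (hw₀.trans (by linarith)) hw₂
  set P := totalDensity F with hP
  have hP3 : ∀ t, 0 ≤ 3 - P t := fun t => sub_nonneg.2 (totalDensity_le F t)
  have hsym : ∀ t s, t + s = n → (n.choose t : ℚ) = n.choose s := by
    intro t s h
    rw [Nat.choose_symm_of_eq_add h.symm]
  have low : ∑ j ∈ range (M + 3), (n.choose j : ℚ) * P j =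
      ∑ i ∈ range (M + 1), (n.choose (M - i) : ℚ) * P (M - i) +
        n.choose (M + 1) * P (M + 1) + n.choose (M + 2) * P (M + 2) := by
    rw [sum_range_succ, sum_range_succ, ← sum_range_reflect]
    simp
  have high : ∑ i ∈ range (M + 3), (n.choose (2 * M + 6 + i) : ℚ) * P (2 * M + 6 + i) =
      ∑ i ∈ range (M + 1), (n.choose (M - i) : ℚ) * P (2 * M + 8 + i) +
        n.choose (M + 1) * P (2 * M + 7) + n.choose (M + 2) * P (2 * M + 6) := by
    rw [sum_range_succ', sum_range_succ', hsym (2 * M + 6 + 0) (M + 2) (by omega),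
      hsym (2 * M + 6 + (0 + 1)) (M + 1) (by omega)]
    congr 2
    refine sum_congr rfl fun i hi => ?_
    simp at hi
    rw [hsym _ (M - i) (by omega)]
    congr 2
    omega
  have mid : ∑ i ∈ range (M + 3), (n.choose (M + 3 + i) : ℚ) * (3 - P (M + 3 + i)) =
      ∑ i ∈ range (M + 1), (n.choose (M + 4 + i) : ℚ) * (3 - P (M + 4 + i)) +
        n.choose (M + 3) * (3 - P (M + 3)) + n.choose (M + 3) * (3 - P (2 * M + 5)) := by
    rw [sum_range_succ', sum_range_succ]
    rw [show M + 3 + (M + 1 + 1) = 2 * M + 5 by omega, hsym (2 * M + 5) (M + 3) (by omega)]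
    simp only [show ∀ i, M + 3 + (i + 1) = M + 4 + i by intro i; omega]
    simp only [add_zero]
    ring
  have hS := sum_choose_sub_le (n := n) (q := M) (by omega) (le_refl (M + 1))
  have tail : ∀ (Q : ℕ → ℚ) (s : ℕ),
      (∀ i < M + 1, Q i ≤ (3 - P (M + 4 + i)) + (3 - P s)) →
      ∑ i ∈ range (M + 1), (n.choose (M - i) : ℚ) * Q i ≤
      n.choose M * ∑ i ∈ range (M + 1), (3 - P (M + 4 + i)) + 2 * n.choose M * (3 - P s) := by
    intro Q s hQ
    have h1 : ∀ i ∈ range (M + 1), (n.choose (M - i) : ℚ) * Q i ≤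
        n.choose M * (3 - P (M + 4 + i)) + n.choose (M - i) * (3 - P s) := by
      intro i hi
      have h2 := hQ i (by simpa using hi)
      have h3 : (n.choose (M - i) : ℚ) ≤ n.choose M := by
        exact_mod_cast choose_le_choose_of_add_le (by omega) (by omega)
      have h4 := mul_le_mul_of_nonneg_right h3 (hP3 (M + 4 + i))
      have h5 : (0 : ℚ) ≤ n.choose (M - i) := by positivity
      have h6 := mul_le_mul_of_nonneg_left h2 h5
      linarith
    have h2 := sum_le_sum h1
    rw [sum_add_distrib, ← mul_sum, ← sum_mul] at h2
    have h4 := mul_le_mul_of_nonneg_right hS (hP3 s)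
    linarith
  have tail₁ := tail (fun i => P (M - i)) (2 * M + 4) fun i hi => by
    have h2 := hF.totalDensity_add_le (s := M - i) (t := M + 4 + i) (by omega)
    rw [show M - i + (M + 4 + i) = 2 * M + 4 by omega] at h2
    simp only [← hP] at h2
    linarith
  have tail₂ := tail (fun i => P (2 * M + 8 + i)) (M + 4) fun i hi => by
    have h2 := hF.totalDensity_add_le (s := M + 4) (t := M + 4 + i) (by omega)
    rw [show M + 4 + (M + 4 + i) = 2 * M + 8 + i by omega] at h2
    simp only [← hP] at h2
    linarith
  -- As M ≥ 1, the endpoints are distinct layers. The heavier charge is covered since 5C(n,M+1) +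
  -- 4C(n,M) < 7C(n,M+1) < C(n,M+4).
  have ends := sum_with_endpoints (k := M)
    (g := fun i => (n.choose (M + 4 + i) : ℚ) - 2 * n.choose M) (E := fun i => 3 - P (M + 4 + i))
    (α := 2 * n.choose (M + 1) + 2 * n.choose M) (β := 5 * n.choose (M + 1) + 2 * n.choose M)
    (fun i => hP3 _) (by
      intro i hi
      have hge : (n.choose (M + 1) : ℚ) ≤ n.choose (M + 4 + i) := by
        exact_mod_cast choose_le_choose_of_add_le (by omega) (by omega)
      split_ifs with h1 h2 h2
      · omega
      · rw [h1, hsym (M + 4 + M) (M + 4) (by omega)]; linarith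
      · rw [h2, add_zero]; linarith
      · linarith)
  simp only [sub_mul] at ends
  rw [sum_sub_distrib] at ends
  simp only [mul_assoc, ← mul_sum] at ends
  rw [show M + 4 + M = 2 * M + 4 by omega, add_zero] at ends
  obtain ⟨ends₁, ends₂⟩ := ends
  rw [low, high, mid, ← hw₃]
  constructor
  · linarith
  · intro hle
    have hfull : ∀ i S, M + 4 ≤ S.card → S.card ≤ 2 * M + 4 → S ∈ F i := by
      intro i S h1 h2
      have h3 := ends₂ (by linarith) (S.card - (M + 4)) (by omega)
      rw [show M + 4 + (S.card - (M + 4)) = S.card by omega] at h3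
      exact mem_of_totalDensity (by linarith) i
    exact ⟨hfull, core_eq (by linarith) hfull⟩

/-! ### Exchange arguments for uniform families -/

/-- A property of finite sets preserved by exchanging one element towards a target `T` of the
same cardinality holds for `T` as soon as it holds for some set. -/
lemma of_exchange {α : Type*} [DecidableEq α] {p : Finset α → Prop} {T : Finset α}
    (hp : ∀ S, p S → S.card = T.card → ∀ a ∈ S, a ∉ T → ∀ b ∈ T, b ∉ S → p (insert b (S.erase a)))
    {S : Finset α} (hS : p S) (hST : S.card = T.card) : p T := by
  induction hk : (T \ S).card generalizing S with
  | zero =>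
    rw [card_eq_zero, sdiff_eq_empty_iff_subset] at hk
    rwa [eq_of_subset_of_card_le hk hST.le]
  | succ k ih =>
    have h1 : (S \ T).card = (T \ S).card := by
      have h2 := card_sdiff_add_card_inter S T
      have h3 := card_sdiff_add_card_inter T S
      rw [inter_comm] at h3
      omega
    obtain ⟨b, hb⟩ : (T \ S).Nonempty := card_pos.1 (by omega)
    obtain ⟨a, ha⟩ : (S \ T).Nonempty := card_pos.1 (by omega)
    rw [mem_sdiff] at ha hb
    refine ih (hp S hS hST a ha.1 ha.2 b hb.1 hb.2) ?_ ?_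
    · rw [card_insert_of_notMem (by simp [hb.2]), card_erase_of_mem ha.1]
      have := card_pos.2 ⟨a, ha.1⟩
      omega
    · have h2 : T \ insert b (S.erase a) = (T \ S).erase b := by
        ext x
        simp only [mem_sdiff, mem_insert, mem_erase, not_or, not_and]
        constructor
        · rintro ⟨hx, hxb, hxa⟩
          exact ⟨hxb, hx, hxa (by rintro rfl; exact ha.2 hx)⟩
        · rintro ⟨hxb, hx, hxS⟩
          exact ⟨hx, hxb, fun _ => hxS⟩
      rw [h2, card_erase_of_mem (by simp [hb]), hk]
      rfl

lemma exists_disjoint_card {n k : ℕ} (S : Finset (Fin n)) (h : S.card + k ≤ n) :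
    ∃ T : Finset (Fin n), Disjoint S T ∧ T.card = k := by
  obtain ⟨T, hT, hc⟩ := exists_subset_card_eq (s := Sᶜ) (n := k)
    (by rw [card_compl, Fintype.card_fin]; omega)
  exact ⟨T, disjoint_compl_right.mono_right hT, hc⟩

/-- A nonempty intersecting `K`-uniform family on `3K - 1` points such that the number of members in
a partition of a `2K`-set into two `K`-sets depends on the `2K`-set only is a star. -/
lemma star_of_balanced {n K : ℕ} (hn : n + 1 = 3 * K) (hK : 2 ≤ K) {G : Finset (Fin n) → Prop}
    (hint : ∀ S T, S.card = K → T.card = K → Disjoint S T → ¬ (G S ∧ G T))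
    (hbal : ∀ S T S' T', S.card = K → T.card = K → S'.card = K → T'.card = K → Disjoint S T →
      Disjoint S' T' → S ∪ T = S' ∪ T' → G S → (G S' ↔ ¬ G T'))
    {S₀ : Finset (Fin n)} (hS₀ : S₀.card = K) (hG : G S₀) :
    ∃ a, ∀ T, T.card = K → (G T ↔ a ∈ T) := by
  -- The 2K-set S ∪ W + b splits into S and W + b, and also into S - a + b and W + a.
  have swap : ∀ S, S.card = K → G S → ∀ a ∈ S, ∀ b ∉ S, ∀ W, W.card + 1 = K → Disjoint S W →
      b ∉ W → (G (insert b (S.erase a)) ↔ ¬ G (insert a W)) := by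
    intro S hS hGS a ha b hb W hW hd hbW
    have haW : a ∉ W := disjoint_left.1 hd ha
    have hab : a ≠ b := by rintro rfl; exact hb ha
    refine hbal S (insert b W) _ _ hS (by rw [card_insert_of_notMem hbW, hW]) ?_
      (by rw [card_insert_of_notMem haW, hW]) ?_ ?_ ?_ hGS
    · rw [card_insert_of_notMem (by simp [hb]), card_erase_of_mem ha]; omega
    · rw [disjoint_insert_right]; exact ⟨hb, hd⟩
    · rw [disjoint_left] at hd ⊢
      intro x hx
      simp only [mem_insert, mem_erase] at hx ⊢
      rcases hx with rfl | ⟨h1, h2⟩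
      · rintro (h | h)
        · exact hab h.symm
        · exact hbW h
      · rintro (h | h)
        · exact h1 h
        · exact hd h2 h
    · ext x
      simp only [mem_union, mem_insert, mem_erase]
      by_cases hx : x = a
      · subst hx; simp [ha]
      · simp [hx]; tauto
  -- Membership of W + a does not depend on W: S ∪ W ∪ W' has at most 3K - 2 < n points, so some b
  -- remains, and both W + a and W' + a are opposite to S - a + b.
  have spread : ∀ S, S.card = K → G S → ∀ a ∈ S, (∃ W, W.card + 1 = K ∧ Disjoint S W ∧
      G (insert a W)) → ∀ W, W.card + 1 = K → Disjoint S W → G (insert a W) := by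
    rintro S hS hGS a ha ⟨W, hW, hd, hGW⟩ W' hW' hd'
    obtain ⟨B, hB, hB1⟩ := exists_disjoint_card (k := 1) (S ∪ (W ∪ W')) (by
      have := card_union_le S (W ∪ W')
      have := card_union_le W W'
      omega)
    obtain ⟨b, rfl⟩ := card_eq_one.1 hB1
    simp only [disjoint_singleton_right, mem_union, not_or] at hB
    have h1 := swap S hS hGS a ha b hB.1 W hW hd hB.2.1
    have h2 := swap S hS hGS a ha b hB.1 W' hW' hd' hB.2.2
    by_contra h3
    exact (h1.1 (h2.2 h3)) hGW
  -- Call a a centre of S if some, hence every, such W + a belongs to G. A centre survives exchanges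
  -- that keep it, so all K-sets through a belong to G. Without centres G is closed under all
  -- exchanges and contains all K-sets, against `hint`.
  by_cases hcent : ∃ S, S.card = K ∧ G S ∧ ∃ a ∈ S, ∃ W, W.card + 1 = K ∧ Disjoint S W ∧
      G (insert a W)
  · obtain ⟨S, hS, hGS, a, ha, hW⟩ := hcent
    have hin : ∀ T, T.card = K → a ∈ T → G T := by
      intro T hT haT
      have := of_exchange (T := T) (p := fun S => G S ∧ a ∈ S ∧
          ∃ W, W.card + 1 = K ∧ Disjoint S W ∧ G (insert a W)) ?_ ⟨hGS, ha, hW⟩ (hS.trans hT.symm)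
      · exact this.1
      rintro S ⟨hGS, ha, hW⟩ hST a' ha' ha'T b hbT hbS
      rw [hT] at hST
      have hall := spread S hST hGS a ha hW
      have haa' : a ≠ a' := by rintro rfl; exact ha'T haT
      obtain ⟨W₁, hW₁d, hW₁⟩ := exists_disjoint_card (k := K - 1) (insert b S) (by
        have := card_insert_le b S
        omega)
      rw [disjoint_insert_left] at hW₁d
      obtain ⟨W₂, hW₂d, hW₂⟩ := exists_disjoint_card (k := K - 1) (S ∪ W₁) (by
        have := card_union_le S W₁
        omega)
      rw [disjoint_union_left] at hW₂d
      refine ⟨?_, by simp [haa', ha], W₁, by omega, ?_, hall W₁ (by omega) hW₁d.2⟩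
      · rw [swap S hST hGS a' ha' b hbS W₁ (by omega) hW₁d.2 hW₁d.1]
        intro hGW₁
        -- If the exchange left G, then W₁ + a' and W₂ + a would be disjoint members.
        refine hint (insert a' W₁) (insert a W₂) ?_ ?_ ?_ ⟨hGW₁, hall W₂ (by omega) hW₂d.1⟩
        · rw [card_insert_of_notMem (disjoint_left.1 hW₁d.2 ha')]; omega
        · rw [card_insert_of_notMem (disjoint_left.1 hW₂d.1 ha)]; omega
        · rw [disjoint_insert_left, disjoint_insert_right, mem_insert, not_or]
          exact ⟨⟨haa'.symm, disjoint_left.1 hW₂d.1 ha'⟩, disjoint_left.1 hW₁d.2 ha, hW₂d.2⟩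
      · rw [disjoint_insert_left]
        exact ⟨hW₁d.1, hW₁d.2.mono_left (erase_subset _ _)⟩
    refine ⟨a, fun T hT => ⟨fun hGT => ?_, hin T hT⟩⟩
    by_contra haT
    obtain ⟨W, hWd, hW⟩ := exists_disjoint_card (k := K - 1) (insert a T) (by
      have := card_insert_le a T
      omega)
    rw [disjoint_insert_left] at hWd
    have hc : (insert a W).card = K := by rw [card_insert_of_notMem hWd.1]; omega
    refine hint T (insert a W) hT hc ?_ ⟨hGT, hin _ hc (mem_insert_self _ _)⟩
    rw [disjoint_insert_right]; exact ⟨haT, hWd.2⟩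
  · exfalso
    push Not at hcent
    have hall : ∀ T : Finset (Fin n), T.card = K → G T := by
      intro T hT
      refine of_exchange (T := T) (p := G) ?_ hG (hS₀.trans hT.symm)
      intro S hGS hST a ha _ b _ hb
      rw [hT] at hST
      obtain ⟨W, hWd, hW⟩ := exists_disjoint_card (k := K - 1) (insert b S) (by
        have := card_insert_le b S
        omega)
      rw [disjoint_insert_left] at hWd
      rw [swap S hST hGS a ha b hb W (by omega) hWd.2 hWd.1]
      exact hcent S hST hGS a ha W (by omega) hWd.2
    obtain ⟨T, hd, hT⟩ := exists_disjoint_card (k := K) S₀ (by omega)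
    exact hint S₀ T hS₀ hT hd ⟨hG, hall T hT⟩

/-! ### The extremal families for `n = 3m + 2` -/

lemma layers_two {M n : ℕ} (hn : n = 3 * (M + 2) + 2) {F : Fin 3 → Finset (Finset (Fin n))}
    (hF : CrossFree F) (hfull : ∀ i S, M + 4 ≤ S.card → S.card ≤ 2 * M + 4 → S ∈ F i)
    (hloc : ∀ (ρ : Equiv.Perm (Fin 3)), ∀ d ∈ colorings n ![M + 1, 1, M + 1, 1, M + 3, 1],
        colorUnion d {0} ∉ F (ρ 0) ∧ colorUnion d {1, 2, 3, 4, 5} ∉ F (ρ 0) ∧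
        (colorUnion d {0, 1} ∈ F (ρ 0) →
          colorUnion d {4} ∈ F (ρ 1) ∧ colorUnion d {2, 3, 5} ∉ F (ρ 2)) ∧
        (colorUnion d {0, 1} ∉ F (ρ 0) → colorUnion d {2, 3} ∉ F (ρ 2) →
          ind (F (ρ 0)) (colorUnion d {2, 3, 4, 5}) =
            (1 - ind (F (ρ 1)) (colorUnion d {4})) + (1 - ind (F (ρ 2)) (colorUnion d {2, 3, 5})) ∧
          colorUnion d {0, 1, 2, 3, 5} ∈ F (ρ 1))) (hM : 1 ≤ M) :
    (∀ i S, S.card ≤ M + 2 → S ∉ F i) ∧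
    (∀ i S, M + 4 ≤ S.card → S.card ≤ 2 * M + 5 → S ∈ F i) ∧
    (∀ i S, 2 * M + 7 ≤ S.card → S ∉ F i) ∧
    (∀ (ρ : Equiv.Perm (Fin 3)) S T, S.card = M + 3 → T.card = M + 3 → Disjoint S T →
      ind (F (ρ 0)) (S ∪ T) = (1 - ind (F (ρ 1)) S) + (1 - ind (F (ρ 2)) T)) := by
  have hk : ∑ i, ![M + 1, 1, M + 1, 1, M + 3, 1] i = n := by
    simp [Fin.sum_univ_six]; omega
  have real : ∀ {s t : Finset (Fin 6)}, Disjoint s t → ∀ {S T : Finset (Fin n)}, Disjoint S T →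
      S.card = ∑ i ∈ s, ![M + 1, 1, M + 1, 1, M + 3, 1] i →
      T.card = ∑ i ∈ t, ![M + 1, 1, M + 1, 1, M + 3, 1] i →
      ∃ c ∈ colorings n ![M + 1, 1, M + 1, 1, M + 3, 1],
        colorUnion c s = S ∧ colorUnion c t = T := fun hst _ _ hST => exists_coloring _ hk hst hST
  have no_sum : ∀ i S T, M + 4 ≤ T.card → T.card ≤ 2 * M + 4 → Disjoint S T →
      M + 4 ≤ (S ∪ T).card → (S ∪ T).card ≤ 2 * M + 4 → S ∉ F i := by
    intro i S T h1 h2 hd h3 h4 hS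
    exact hF.comp (Equiv.swap 0 i) (i := 0) (j := 1) (k := 2)
      (by rwa [Equiv.swap_apply_left]) (hfull _ T h1 h2) hd (hfull _ _ h3 h4) (by decide)
  have low : ∀ i S, S.card ≤ M + 2 → S ∉ F i := by
    intro i S hS hSi
    by_cases h2 : S.card = M + 2
    -- T read as {4} has to lie in the family of role 1; read as {2, 3, 5}, with roles 1 and 2
    -- exchanged, it must avoid the same family.
    · obtain ⟨T, hd, hT⟩ := exists_disjoint_card (k := M + 3) S (by omega)
      obtain ⟨c, hc, hcS, hcT⟩ := real (s := {0, 1}) (t := {4}) (by decide) hd (by simp [h2])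
        (by simp [hT])
      obtain ⟨d, hd, hdS, hdT⟩ := real (s := {0, 1}) (t := {2, 3, 5}) (by decide) hd
        (by simp [h2]) (by simp [hT])
      have k1 := ((hloc (Equiv.swap 0 i) c hc).2.2.1 (by
        rw [hcS, Equiv.swap_apply_left]; exact hSi)).1
      have k2 := ((hloc (Equiv.swap 0 i * Equiv.swap 1 2) d hd).2.2.1 (by
        rw [hdS, Equiv.Perm.mul_apply, show Equiv.swap (1 : Fin 3) 2 0 = 0 by decide,
          Equiv.swap_apply_left]
        exact hSi)).2
      rw [hdT, Equiv.Perm.mul_apply, Equiv.swap_apply_right, ← hcT] at k2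
      exact k2 k1
    by_cases h1 : S.card = M + 1
    · obtain ⟨c, hc, hcS, -⟩ := real (s := {0}) (t := ∅) (by decide) (disjoint_empty_right S)
        (by simp [h1]) (by simp)
      have := (hloc (Equiv.swap 0 i) c hc).1
      rw [hcS, Equiv.swap_apply_left] at this
      exact this hSi
    · obtain ⟨T, hd, hT⟩ := exists_disjoint_card (k := M + 4) S (by omega)
      refine no_sum i S T hT.ge (by omega) hd ?_ ?_ hSi <;> rw [card_union_of_disjoint hd] <;> omega
  refine ⟨low, ?_, ?_, ?_⟩
  · intro i S h1 h2
    by_cases h3 : S.card = 2 * M + 5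
    · obtain ⟨c, hc, hcS, -⟩ := real (s := {0, 1, 2, 3, 5}) (t := ∅) (by decide)
        (disjoint_empty_right S) (by simp [h3]; omega) (by simp)
      have hcard := card_colorUnion hc
      have := ((hloc (Equiv.swap 1 i) c hc).2.2.2 (low _ _ (by rw [hcard]; simp))
        (low _ _ (by rw [hcard]; simp))).2
      rwa [hcS, Equiv.swap_apply_left] at this
    · exact hfull i S h1 (by omega)
  · intro i S h hSi
    have hS : S.card ≤ n := by simpa using card_le_univ S
    by_cases h1 : S.card = 2 * M + 7
    · obtain ⟨c, hc, hcS, -⟩ := real (s := {1, 2, 3, 4, 5}) (t := ∅) (by decide)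
        (disjoint_empty_right S) (by simp [h1]; omega) (by simp)
      have := (hloc (Equiv.swap 0 i) c hc).2.1
      rw [hcS, Equiv.swap_apply_left] at this
      exact this hSi
    · obtain ⟨T, hT, hTc⟩ := exists_subset_card_eq (s := S) (n := M + 4) (by omega)
      have hU : (S \ T).card = S.card - (M + 4) := by rw [card_sdiff_of_subset hT, hTc]
      refine hF.comp (Equiv.swap 2 i) (i := 0) (j := 1) (k := 2)
        (hfull _ T hTc.ge (by omega)) (hfull _ (S \ T) (by omega) (by omega)) disjoint_sdiff ?_
        (by decide)
      rw [union_sdiff_of_subset hT, Equiv.swap_apply_left]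
      exact hSi
  · intro ρ S T hS hT hd
    obtain ⟨c, hc, hcS, hcT⟩ := real (s := {4}) (t := {2, 3, 5}) (by decide) hd (by simp [hS])
      (by simp [hT])
    have hcard := card_colorUnion hc
    have := ((hloc ρ c hc).2.2.2 (low _ _ (by rw [hcard]; simp)) (low _ _ (by rw [hcard]; simp))).1
    rwa [show ({2, 3, 4, 5} : Finset (Fin 6)) = {4} ∪ {2, 3, 5} by decide, colorUnion_union, hcS,
      hcT] at this

/-! ### Relabelling, and the sizes of the extremal families. -/

lemma mem_relabel {n : ℕ} {τ : Equiv.Perm (Fin n)} {F : Finset (Finset (Fin n))}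
    {S : Finset (Fin n)} : S ∈ relabel τ F ↔ S.image τ.symm ∈ F := by
  simp only [relabel, mem_image]
  constructor
  · rintro ⟨T, hT, rfl⟩
    simpa [image_image] using hT
  · intro h
    exact ⟨_, h, by simp [image_image]⟩

lemma relabel_one {n : ℕ} (F : Finset (Finset (Fin n))) : relabel 1 F = F := by
  simp [relabel]

lemma card_relabel {n : ℕ} (τ : Equiv.Perm (Fin n)) (F : Finset (Finset (Fin n))) :
    (relabel τ F).card = F.card :=
  card_image_of_injective _ (image_injective τ.injective)

lemma mem_double_layers {n a b : ℕ} {S : Finset (Fin (n + 1))} :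
    S ∈ double (layers n a b) ↔
      a ≤ (S.erase (Fin.last n)).card ∧ (S.erase (Fin.last n)).card ≤ b := by
  have h : (univ.filter fun x : Fin n => x.castSucc ∈ S).map Fin.castSuccEmb =
      S.erase (Fin.last n) := by
    ext x
    simp only [mem_map, mem_filter, mem_univ, true_and, mem_erase, Fin.coe_castSuccEmb]
    constructor
    · rintro ⟨y, hy, rfl⟩
      exact ⟨Fin.castSucc_ne_last y, hy⟩
    · rintro ⟨hx, hxS⟩
      exact ⟨x.castPred hx, by simpa using hxS, by simp⟩
  simp only [double, mem_filter, mem_univ, true_and, mem_layers, ← h, card_map]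

lemma card_double {n : ℕ} (F : Finset (Finset (Fin n))) : (double F).card = 2 * F.card := by
  have h : (double F).card = (F ×ˢ (univ : Finset Bool)).card := by
    refine card_bij' (fun S _ => (univ.filter fun x : Fin n => x.castSucc ∈ S,
        decide (Fin.last n ∈ S)))
      (fun p _ => p.1.map Fin.castSuccEmb ∪ if p.2 then {Fin.last n} else ∅) ?_ ?_ ?_ ?_
    · intro S hS
      have : Fin.last n ∈ S ∨ Fin.last n ∉ S := em _
      simpa [double, this] using hS
    · rintro ⟨T, b⟩ hT
      simp only [mem_product, mem_univ, and_true] at hT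
      have : (univ.filter fun x : Fin n =>
          x.castSucc ∈ T.map Fin.castSuccEmb ∪ if b then {Fin.last n} else ∅) = T := by
        ext x; cases b <;> simp
      simp only [double, mem_filter, mem_univ, true_and, this, hT]
    · intro S _
      ext x
      refine Fin.lastCases ?_ (fun y => ?_) x
      · by_cases h : Fin.last n ∈ S <;> simp [h]
      · by_cases h : Fin.last n ∈ S <;> simp [h]
    · rintro ⟨T, b⟩ _
      ext x
      · cases b <;> simp
      · cases b <;> simp
  rw [h, card_product]
  simp [mul_comm]

/-- Pascal's rule splits the left side into two sums of row 3m+1, over m+1, ..., 2m+1 and over m,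
..., 2m; symmetry of the row exchanges these ranges. -/
lemma sum_choose_double (m : ℕ) :
    ∑ t ∈ Icc (m + 1) (2 * m + 1), (3 * m + 2).choose t =
      2 * ∑ t ∈ Icc (m + 1) (2 * m + 1), (3 * m + 1).choose t := by
  have key : ∀ f : ℕ → ℕ, ∑ t ∈ Icc (m + 1) (2 * m + 1), f t = ∑ i ∈ range (m + 1), f (m + 1 + i) := by
    intro f
    rw [← Finset.Ico_succ_right_eq_Icc, Finset.sum_Ico_eq_sum_range]
    simp [show 2 * m + 1 + 1 - (m + 1) = m + 1 by omega]
  rw [key, key, two_mul]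
  nth_rw 2 [← sum_range_reflect]
  rw [← sum_add_distrib]
  refine sum_congr rfl fun i hi => ?_
  simp only [mem_range] at hi
  rw [show m + 1 + i = (m + i) + 1 by omega, Nat.choose_succ_succ,
    Nat.choose_symm_of_eq_add (show 3 * m + 1 = (m + i) + (m + 1 + (m + 1 - 1 - i)) by omega)]

/-- Compared with three copies of the layers m+1, ..., 2m+1, one layer m+1 is lost and two layers
2m+2 are gained; 2C(n,2m+2) = 2C(n,m) = C(n,m+1). -/
lemma sum_card_layers (M : ℕ) :
    (layers (3 * (M + 2) + 2) (M + 4) (2 * M + 5)).card +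
      2 * (layers (3 * (M + 2) + 2) (M + 3) (2 * M + 6)).card =
    3 * ∑ t ∈ Icc (M + 3) (2 * M + 5), (3 * (M + 2) + 2).choose t := by
  set n := 3 * (M + 2) + 2 with hn
  rw [card_layers, card_layers]
  have h1 : ∑ t ∈ Icc (M + 3) (2 * M + 5), n.choose t =
      n.choose (M + 3) + ∑ t ∈ Icc (M + 4) (2 * M + 5), n.choose t := by
    rw [← Finset.add_sum_Ioc_eq_sum_Icc (by omega)]
    congr 2
    ext t
    simp only [mem_Ioc, mem_Icc]
    omega
  have h2 : ∑ t ∈ Icc (M + 3) (2 * M + 6), n.choose t =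
      ∑ t ∈ Icc (M + 3) (2 * M + 5), n.choose t + n.choose (2 * M + 6) :=
    Finset.sum_Icc_succ_top (by omega) _
  have h3 : n.choose (2 * M + 6) = n.choose (M + 2) :=
    Nat.choose_symm_of_eq_add (by omega)
  have h4 : 2 * n.choose (M + 2) = n.choose (M + 3) := by
    have := (choose_ineq_two hn).2.2.2.1
    exact_mod_cast this
  rw [h2, h3]
  omega

/-! ### Classification of the extremal triples for n = 3m + 2. -/

lemma exists_perm_fin_three : ∀ i j k : Fin 3, i ≠ j → i ≠ k → j ≠ k →
    ∃ ρ : Equiv.Perm (Fin 3), ρ 0 = i ∧ ρ 1 = j ∧ ρ 2 = k := by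
  decide

lemma exists_third : ∀ j k : Fin 3, j ≠ k → ∃ i : Fin 3, i ≠ j ∧ i ≠ k := by
  decide

/-- A cross partition-free triple attaining the bound whose members are determined outside the
layers `M + 3` and `2M + 6` and are linked on these two layers is one of the three examples. -/
lemma classify_two {M n : ℕ} (hn : n = 3 * (M + 2) + 2) {F : Fin 3 → Finset (Finset (Fin n))}
    (low : ∀ i S, S.card ≤ M + 2 → S ∉ F i)
    (mid : ∀ i S, M + 4 ≤ S.card → S.card ≤ 2 * M + 5 → S ∈ F i)
    (high : ∀ i S, 2 * M + 7 ≤ S.card → S ∉ F i)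
    (rel : ∀ i j k, i ≠ j → i ≠ k → j ≠ k → ∀ S T, S.card = M + 3 → T.card = M + 3 →
      Disjoint S T → ind (F i) (S ∪ T) = (1 - ind (F j) S) + (1 - ind (F k) T)) :
    (∀ i, F i = layers n (M + 3) (2 * M + 5)) ∨
    (∃ a, ∀ i S, S ∈ F i ↔ M + 3 ≤ (S.erase a).card ∧ (S.erase a).card ≤ 2 * M + 5) ∨
    ∃ σ : Equiv.Perm (Fin 3), F (σ 0) = layers n (M + 4) (2 * M + 5) ∧
      F (σ 1) = layers n (M + 3) (2 * M + 6) ∧ F (σ 2) = layers n (M + 3) (2 * M + 6) := by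
  have split : ∀ C : Finset (Fin n), C.card = 2 * M + 6 → ∃ S T, S.card = M + 3 ∧ T.card = M + 3 ∧
      Disjoint S T ∧ S ∪ T = C := by
    intro C hC
    obtain ⟨S, hS, hSc⟩ := exists_subset_card_eq (s := C) (n := M + 3) (by omega)
    exact ⟨S, C \ S, hSc, by rw [card_sdiff_of_subset hS]; omega, disjoint_sdiff,
      union_sdiff_of_subset hS⟩
  -- If the families agree on layer m+1, two disjoint sets cannot both be missing, as the right side
  -- of `rel` would be 2, and the number of missing halves of a (2m+2)-set is the same for every
  -- splitting.
  by_cases heq : ∀ i j S, S.card = M + 3 → S ∈ F i → S ∈ F j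
  · have key : ∀ i S T, S.card = M + 3 → T.card = M + 3 → Disjoint S T →
        ind (F i) (S ∪ T) = (1 - ind (F 0) S) + (1 - ind (F 0) T) := by
      intro i S T hS hT hd
      have h1 : ∀ j S, S.card = M + 3 → ind (F j) S = ind (F 0) S := fun j S hS => by
        unfold ind
        rw [if_congr ⟨heq j 0 S hS, heq 0 j S hS⟩ rfl rfl]
      obtain ⟨j, k, hij, hik, hjk⟩ : ∃ j k : Fin 3, i ≠ j ∧ i ≠ k ∧ j ≠ k := by
        revert i; decide
      rw [rel i j k hij hik hjk S T hS hT hd, h1 j S hS, h1 k T hT]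
    have hnot : ∀ S T, S.card = M + 3 → T.card = M + 3 → Disjoint S T →
        ¬ (S ∉ F 0 ∧ T ∉ F 0) := by
      rintro S T hS hT hd ⟨h1, h2⟩
      have h3 := key 0 S T hS hT hd
      rw [ind_eq_zero.2 h1, ind_eq_zero.2 h2] at h3
      rcases ind_eq_zero_or_one (F 0) (S ∪ T) with h | h <;> rw [h] at h3 <;> norm_num at h3
    by_cases hG : ∃ S₀ : Finset (Fin n), S₀.card = M + 3 ∧ S₀ ∉ F 0
    · right; left
      obtain ⟨S₀, hS₀, hG⟩ := hG
      obtain ⟨a, ha⟩ := star_of_balanced (n := n) (K := M + 3) (G := fun S => S ∉ F 0) (by omega)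
        (by omega) hnot (by
          intro S T S' T' hS hT hS' hT' hd hd' hU hGS
          have h1 := key 0 S T hS hT hd
          have h2 := key 0 S' T' hS' hT' hd'
          have h3 : T ∈ F 0 := by
            by_contra h
            exact hnot S T hS hT hd ⟨hGS, h⟩
          rw [hU, h2, ind_eq_zero.2 hGS, ind_eq_one.2 h3] at h1
          rw [not_not, ← ind_eq_zero, ← ind_eq_one]
          constructor
          · intro h; rw [h] at h1; linarith
          · intro h; rw [h] at h1; linarith) hS₀ hG
      have ind_star : ∀ S, S.card = M + 3 → 1 - ind (F 0) S = if a ∈ S then 1 else 0 := by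
        intro S hS
        split_ifs with h
        · rw [ind_eq_zero.2 ((ha S hS).2 h)]; norm_num
        · rw [ind_eq_one.2 (not_not.1 fun h' => h ((ha S hS).1 h'))]; norm_num
      refine ⟨a, fun i S => ?_⟩
      have herase : (S.erase a).card + (if a ∈ S then 1 else 0) = S.card := by
        split_ifs with h
        · exact card_erase_add_one h
        · rw [erase_eq_of_notMem h]; rfl
      rcases lt_or_ge S.card (M + 3) with h1 | h1
      · exact iff_of_false (low i S (by omega)) (by omega)
      rcases h1.eq_or_lt with h1 | h1
      · have h2 : S ∈ F i ↔ a ∉ S := by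
          rw [← ha S h1.symm, not_not]
          exact ⟨heq i 0 S h1.symm, heq 0 i S h1.symm⟩
        rw [h2]
        split_ifs at herase with h3
        · simp only [h3, not_true_eq_false, false_iff]; omega
        · simp only [h3, not_false_eq_true, true_iff]; omega
      rcases le_or_gt S.card (2 * M + 5) with h2 | h2
      · refine iff_of_true (mid i S h1 h2) ?_
        split_ifs at herase <;> omega
      rcases le_or_gt S.card (2 * M + 6) with h3 | h3
      · obtain ⟨U, T, hU, hT, hd, rfl⟩ := split S (by omega)
        rw [← ind_eq_one, key i U T hU hT hd, ind_star U hU, ind_star T hT]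
        by_cases h4 : a ∈ U
        · have h5 : a ∉ T := disjoint_left.1 hd h4
          simp only [mem_union, h4, h5, true_or, if_true, if_false] at herase ⊢
          exact iff_of_true (by norm_num) (by omega)
        · by_cases h5 : a ∈ T
          · simp only [mem_union, h4, h5, or_true, if_true, if_false] at herase ⊢
            exact iff_of_true (by norm_num) (by omega)
          · simp only [mem_union, h4, h5, or_false, if_false] at herase ⊢
            exact iff_of_false (by norm_num) (by omega)
      · refine iff_of_false (high i S (by omega)) ?_
        split_ifs at herase <;> omega
    · left
      push Not at hG
      intro i
      ext S
      rw [mem_layers]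
      rcases lt_or_ge S.card (M + 3) with h1 | h1
      · exact iff_of_false (low i S (by omega)) (by omega)
      rcases h1.eq_or_lt with h1 | h1
      · exact iff_of_true (heq 0 i S h1.symm (hG S h1.symm)) (by omega)
      rcases le_or_gt S.card (2 * M + 5) with h2 | h2
      · exact iff_of_true (mid i S h1 h2) (by omega)
      rcases le_or_gt S.card (2 * M + 6) with h3 | h3
      · obtain ⟨U, T, hU, hT, hd, rfl⟩ := split S (by omega)
        refine iff_of_false ?_ (by omega)
        rw [← ind_eq_zero, key i U T hU hT hd, ind_eq_one.2 (hG U hU), ind_eq_one.2 (hG T hT)]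
        norm_num
      · exact iff_of_false (high i S (by omega)) (by omega)
  · right; right
    push Not at heq
    obtain ⟨k, j, S₀, hS₀, hk, hj⟩ := heq
    have hjk : j ≠ k := by rintro rfl; exact hj hk
    obtain ⟨i, hij, hik⟩ := exists_third j k hjk
    -- As S is not in the j-th family, `rel` forces T into the k-th and S ∪ T into the i-th. The
    -- relation with j and k exchanged then excludes T from the j-th.
    have step : ∀ S T, S.card = M + 3 → T.card = M + 3 → Disjoint S T → S ∈ F k ∧ S ∉ F j →
        T ∈ F k ∧ T ∉ F j := by
      rintro S T hS hT hd ⟨h1, h2⟩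
      have h3 := rel i j k hij hik hjk S T hS hT hd
      have h4 := rel i k j hik hij hjk.symm S T hS hT hd
      rw [ind_eq_zero.2 h2] at h3
      rw [ind_eq_one.2 h1] at h4
      rw [← ind_eq_one, ← ind_eq_zero]
      rcases ind_eq_zero_or_one (F k) T with h5 | h5 <;>
      rcases ind_eq_zero_or_one (F j) T with h6 | h6 <;> rw [h5] at h3 <;> rw [h6] at h4 <;>
      first
      | exact ⟨h5, h6⟩
      | linarith
    have all : ∀ T, T.card = M + 3 → T ∈ F k ∧ T ∉ F j := by
      intro T hT
      refine of_exchange (p := fun S => S ∈ F k ∧ S ∉ F j) ?_ ⟨hk, hj⟩ (hS₀.trans hT.symm)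
      intro S hS hST a ha _ b _ hb
      rw [hT] at hST
      -- A set W disjoint from both S and S - a + b passes the property on in two steps.
      obtain ⟨W, hWd, hW⟩ := exists_disjoint_card (k := M + 3) (insert b S) (by
        have := card_insert_le b S
        omega)
      have hWS := disjoint_insert_left.1 hWd
      refine step W _ hW ?_ ?_ (step S W hST hW hWS.2 hS)
      · rw [card_insert_of_notMem (by simp [hb]), card_erase_of_mem ha]; omega
      · exact (hWd.mono_left (insert_subset_insert b (erase_subset a S))).symm
    have alli : ∀ T, T.card = M + 3 → T ∈ F i := by
      intro T hT
      obtain ⟨S, hd, hS⟩ := exists_disjoint_card (k := M + 3) T (by omega)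
      have h1 := rel k j i hjk.symm hik.symm hij.symm S T hS hT hd.symm
      rw [ind_eq_zero.2 (all S hS).2] at h1
      by_contra h
      rw [ind_eq_zero.2 h] at h1
      rcases ind_eq_zero_or_one (F k) (S ∪ T) with h | h <;> rw [h] at h1 <;> norm_num at h1
    have top : ∀ S T, S.card = M + 3 → T.card = M + 3 → Disjoint S T →
        S ∪ T ∈ F k ∧ S ∪ T ∈ F i ∧ S ∪ T ∉ F j := by
      intro S T hS hT hd
      rw [← ind_eq_one, ← ind_eq_one, ← ind_eq_zero, rel k j i hjk.symm hik.symm hij.symm S T hS hT hd,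
        rel i j k hij hik hjk S T hS hT hd, rel j i k hij.symm hjk hik S T hS hT hd,
        ind_eq_zero.2 (all S hS).2, ind_eq_one.2 (alli T hT), ind_eq_one.2 (all T hT).1,
        ind_eq_one.2 (alli S hS)]
      norm_num
    have big : ∀ l, (∀ T, T.card = M + 3 → T ∈ F l) → (∀ S T, S.card = M + 3 → T.card = M + 3 →
        Disjoint S T → S ∪ T ∈ F l) → F l = layers n (M + 3) (2 * M + 6) := by
      intro l h1 h2
      ext S
      rw [mem_layers]
      rcases lt_or_ge S.card (M + 3) with g1 | g1
      · exact iff_of_false (low l S (by omega)) (by omega)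
      rcases g1.eq_or_lt with g1 | g1
      · exact iff_of_true (h1 S g1.symm) (by omega)
      rcases le_or_gt S.card (2 * M + 5) with g2 | g2
      · exact iff_of_true (mid l S g1 g2) (by omega)
      rcases le_or_gt S.card (2 * M + 6) with g3 | g3
      · obtain ⟨U, T, hU, hT, hd, rfl⟩ := split S (by omega)
        exact iff_of_true (h2 U T hU hT hd) (by omega)
      · exact iff_of_false (high l S (by omega)) (by omega)
    obtain ⟨σ, hσ0, hσ1, hσ2⟩ := exists_perm_fin_three j i k hij.symm hjk hik
    refine ⟨σ, ?_, ?_, ?_⟩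
    · rw [hσ0]
      ext S
      rw [mem_layers]
      rcases lt_or_ge S.card (M + 3) with g1 | g1
      · exact iff_of_false (low j S (by omega)) (by omega)
      rcases g1.eq_or_lt with g1 | g1
      · exact iff_of_false (all S g1.symm).2 (by omega)
      rcases le_or_gt S.card (2 * M + 5) with g2 | g2
      · exact iff_of_true (mid j S g1 g2) (by omega)
      rcases le_or_gt S.card (2 * M + 6) with g3 | g3
      · obtain ⟨U, T, hU, hT, hd, rfl⟩ := split S (by omega)
        exact iff_of_false (top U T hU hT hd).2.2 (by omega)
      · exact iff_of_false (high j S (by omega)) (by omega)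
    · rw [hσ1]
      exact big i alli fun S T hS hT hd => (top S T hS hT hd).2.1
    · rw [hσ2]
      exact big k (fun T hT => (all T hT).1) fun S T hS hT hd => (top S T hS hT hd).1

theorem extremal_two {m : ℕ} (hm : 6 ≤ m) {F : Fin 3 → Finset (Finset (Fin (3 * m + 2)))}
    (hF : CrossFree F) :
    (F 0).card + (F 1).card + (F 2).card
        ≤ 3 * ∑ t ∈ Icc (m + 1) (2 * m + 1), (3 * m + 2).choose t ∧
    ((F 0).card + (F 1).card + (F 2).card
        = 3 * ∑ t ∈ Icc (m + 1) (2 * m + 1), (3 * m + 2).choose t ↔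
      ∃ (σ : Equiv.Perm (Fin 3)) (τ : Equiv.Perm (Fin (3 * m + 2))),
        (∀ i, relabel τ (F (σ i)) = kleitmanFamily (3 * m + 2)) ∨
        (∀ i, relabel τ (F (σ i)) = double (kleitmanFamily (3 * m + 1))) ∨
        (relabel τ (F (σ 0)) = layers (3 * m + 2) (m + 2) (2 * m + 1) ∧
          relabel τ (F (σ 1)) = layers (3 * m + 2) (m + 1) (2 * m + 2) ∧
          relabel τ (F (σ 2)) = layers (3 * m + 2) (m + 1) (2 * m + 2))) := by
  obtain ⟨M, rfl⟩ := Nat.exists_eq_add_of_le' (show 2 ≤ m by omega)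
  have hdiff := sum_choose_sub_sum_card (a := M + 3) (b := M + 2) (c := M + 3) (by omega) F
  rw [show M + 3 + (M + 2) = 2 * (M + 2) + 1 by omega,
    show M + 3 + (M + 2 + 1) = 2 * M + 6 by omega] at hdiff
  obtain ⟨hle, heq⟩ := bound_two rfl (by omega) hF
  have hk1 : (3 * (M + 2) + 1) / 3 = M + 2 := by omega
  have hk2 : (3 * (M + 2) + 2) / 3 = M + 2 := by omega
  refine ⟨?_, fun h => ?_, ?_⟩
  · have : (((F 0).card + (F 1).card + (F 2).card : ℕ) : ℚ) ≤
        ((3 * ∑ t ∈ Icc (M + 3) (2 * (M + 2) + 1), (3 * (M + 2) + 2).choose t : ℕ) : ℚ) := by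
      linarith
    exact_mod_cast this
  · rw [h, sub_self] at hdiff
    obtain ⟨hfull, hloc⟩ := heq (by linarith)
    obtain ⟨low, mid, high, rel⟩ := layers_two rfl hF hfull hloc (by omega)
    rcases classify_two rfl low mid high (fun i j k hij hik hjk S T hS hT hd => by
        obtain ⟨ρ, rfl, rfl, rfl⟩ := exists_perm_fin_three i j k hij hik hjk
        exact rel ρ S T hS hT hd) with h1 | ⟨a, h2⟩ | ⟨σ, h3⟩
    · refine ⟨1, 1, Or.inl fun i => ?_⟩
      rw [relabel_one, Equiv.Perm.one_apply, h1, kleitmanFamily, hk2]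
      rfl
    -- The centre a of the star is moved to the last point, the one that `double` adjoins.
    · refine ⟨1, Equiv.swap a (Fin.last (3 * (M + 2) + 1)), Or.inr (Or.inl fun i => ?_)⟩
      ext S
      rw [mem_relabel, Equiv.Perm.one_apply, h2, kleitmanFamily, hk1]
      refine Iff.trans ?_ (mem_double_layers (n := 3 * (M + 2) + 1) (S := S)).symm
      have hS : ((S.image (Equiv.swap a (Fin.last (3 * (M + 2) + 1))).symm).erase a) =
          (S.erase (Fin.last (3 * (M + 2) + 1))).image
            (Equiv.swap a (Fin.last (3 * (M + 2) + 1))).symm := by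
        rw [image_erase (Equiv.injective _), Equiv.symm_swap, Equiv.swap_apply_right]
      rw [hS, card_image_of_injective _ (Equiv.injective _)]
      rfl
    · refine ⟨σ, 1, Or.inr (Or.inr ?_)⟩
      simp only [relabel_one]
      exact h3
  · rintro ⟨σ, τ, h⟩
    -- For the converse only sizes matter, and neither permutation changes their sum.
    have hsum : (F 0).card + (F 1).card + (F 2).card = (relabel τ (F (σ 0))).card +
        (relabel τ (F (σ 1))).card + (relabel τ (F (σ 2))).card := by
      simp only [card_relabel]
      have := Equiv.sum_comp σ fun i => (F i).card
      rw [Fin.sum_univ_three, Fin.sum_univ_three] at this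
      exact this.symm
    rw [hsum]
    rcases h with h | h | ⟨h0, h1, h2⟩
    · simp only [h, kleitmanFamily, card_layers, hk2]
      ring
    · simp only [h]
      rw [sum_choose_double, card_double, kleitmanFamily, card_layers, hk1]
      ring
    · rw [h0, h1, h2]
      refine Eq.trans ?_ (sum_card_layers M)
      exact (show ∀ x y : ℕ, x + y + y = x + 2 * y by intros; omega) _ _

end

theorem theorem2 (m : ℕ) :
    (2 ≤ m → ∀ F : Fin 3 → Finset (Finset (Fin (3 * m + 1))),
      CrossPartitionFree (F 0) (F 1) (F 2) →
        (F 0).card + (F 1).card + (F 2).card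
            ≤ 3 * ∑ t ∈ Finset.Icc (m + 1) (2 * m + 1), (3 * m + 1).choose t ∧
        ((F 0).card + (F 1).card + (F 2).card
            = 3 * ∑ t ∈ Finset.Icc (m + 1) (2 * m + 1), (3 * m + 1).choose t ↔
          ∀ i, F i = kleitmanFamily (3 * m + 1))) ∧
    (6 ≤ m → ∀ F : Fin 3 → Finset (Finset (Fin (3 * m + 2))),
      CrossPartitionFree (F 0) (F 1) (F 2) →
        (F 0).card + (F 1).card + (F 2).card
            ≤ 3 * ∑ t ∈ Finset.Icc (m + 1) (2 * m + 1), (3 * m + 2).choose t ∧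
        ((F 0).card + (F 1).card + (F 2).card
            = 3 * ∑ t ∈ Finset.Icc (m + 1) (2 * m + 1), (3 * m + 2).choose t ↔
          ∃ (σ : Equiv.Perm (Fin 3)) (τ : Equiv.Perm (Fin (3 * m + 2))),
            (∀ i, relabel τ (F (σ i)) = kleitmanFamily (3 * m + 2)) ∨
            (∀ i, relabel τ (F (σ i)) = double (kleitmanFamily (3 * m + 1))) ∨
            (relabel τ (F (σ 0)) = layers (3 * m + 2) (m + 2) (2 * m + 1) ∧
              relabel τ (F (σ 1)) = layers (3 * m + 2) (m + 1) (2 * m + 2) ∧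
              relabel τ (F (σ 2)) = layers (3 * m + 2) (m + 1) (2 * m + 2)))) :=
  ⟨fun hm _ hF => extremal_one hm hF.crossFree, fun hm _ hF => extremal_two hm hF.crossFree⟩
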